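/- Let $\mathbb T=\mathbb R/\mathbb Z$, let $\mathcal S(\mathbb T)$ be the Fréchet space of infinitely smooth periodic (complex-valued) functions and $\mathcal S'(\mathbb T)$ its topological dual. Write $e_k(x)=\mathrm e^{2\pi\mathrm i kx}$ and $\widehat f_k=\langle f,e_{-k}\rangle$. Fix non-negative Schwartz functions $\varphi_0,\varphi$ on $\mathbb R$ with $\operatorname{Supp}\varphi_0\subset\{|x|\le 2\}$, $\operatorname{Supp}\varphi\subset\{\tfrac12\le|x|\le2\}$ and $\sum_{j\ge0}\varphi_j=1$, where $\varphi_j=\varphi(2^{-j}\cdot)$ for $j\ge1$. For $0<p,q\le\infty$ and $s\in\mathbb R$, let $B^s_{p,q}(\mathbb T)$ be the space of all $f\in\mathcal S'(\mathbb T)$ with $$\Big(\sum_{j\ge0}2^{jsq}\Big\|\sum_{k\in\mathbb Z}\varphi_j(k)\widehat f_k e_k\Big\|_{L_p(\mathbb T)}^q\Big)^{1/q}<\infty$$ (supremum over $j$ of $2^{js}\|\cdot\|_{L_p(\mathbb T)}$ if $q=\infty$), and put $s_f(p,q)=\sup\{s\in\mathbb R:\ f\in B^s_{p,q}(\mathbb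 T)\}$ and $s_f(p)=s_f(p,p)$. For $\gamma\in\mathbb R$ let $\mathrm L_\gamma f=(\mathrm{Id}-\Delta)^{\gamma/2}f=\sum_{k\in\mathbb Z}(1+k^2)^{\gamma/2}\widehat f_k e_k\in\mathcal S'(\mathbb T)$. **Proposition.** Let $f\in\mathcal S'(\mathbb T)\setminus\mathcal S(\mathbb T)$. Then $s_f(p)\in\mathbb R$ and $s_f(p,q)=s_f(p)$ for all $0<p,q\le\infty$, and, with the convention $\frac1\infty=0$: 1. For all $\gamma\in\mathbb R$ and $0<p\le\infty$, $s_{\mathrm L_\gamma f}(p)=s_f(p)-\gamma$. 2. The function $\frac1p\mapsto s_f(p)$ on $[0,\infty)$ has a right derivative $\partial_+s_f(p_0)\in\mathbb R$ at $\frac1{p_0}$ for every $p_0\in(0,\infty]$, and a left derivative $\partial_-s_f(p_0)\in\mathbb R$ at $\frac1{p_0}$ for every $p_0\in(0,\infty)$ (derivatives with respect to the variable $\frac1p$). 3. $\partial_-s_f(p)\ge\partial_+s_f(p)$ for every $0<p<\infty$. 4. The function $\frac1p\mapsto s_f(p)$ is differentiable on $[0,\infty)$ except at at most countably many points. 5.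 If $p_0\in(0,\infty)$ and $\partial_-s_f(p_0)=1$, then $s_f(p)=s_f(p_0)+\frac1p-\frac1{p_0}$ for all $p_0\le p\le\infty$. 6. If $p_0\in(0,\infty]$ and $\partial_+s_f(p_0)=0$, then $s_f(p)=s_f(p_0)$ for all $0<p\le p_0$. 7. If $p_0\in(0,\infty)$, $\partial_-s_f(p_0)=1$ and $\partial_+s_f(p_0)=0$, then for all $0<p\le\infty$ $$s_f(p)=s_f(p_0)-\frac1{p_0}+\frac1{\max(p,p_0)}=s_f(\infty)+\frac1{\max(p,p_0)}.$$ -/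

import Mathlib

open scoped ContDiff ENNReal SchwartzMap

noncomputable section

namespace PeriodicBesov

/-! ### Smooth functions and generalized functions on the torus `ℝ / ℤ` -/

/-- The complex vector space of infinitely smooth `1`-periodic functions on `ℝ`. -/
def smoothPeriodic : Submodule ℂ (ℝ → ℂ) where
  carrier := {u | ContDiff ℝ ∞ u ∧ Function.Periodic u 1}
  add_mem' := fun hu hv => ⟨hu.1.add hv.1, hu.2.add hv.2⟩
  zero_mem' := ⟨contDiff_const, fun _ => rfl⟩
  smul_mem' := fun c _ hu => ⟨contDiff_const.smul hu.1, fun x => by simp [hu.2 x]⟩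

/-- The space `𝒮(𝕋)` of periodic and infinitely smooth functions.  It is a separate type, so that
it carries its Fréchet topology and not the topology of pointwise convergence. -/
def SmoothTorus : Type := ↥smoothPeriodic

namespace SmoothTorus

instance : AddCommGroup SmoothTorus := inferInstanceAs (AddCommGroup ↥smoothPeriodic)

instance : Module ℂ SmoothTorus := inferInstanceAs (Module ℂ ↥smoothPeriodic)

instance : CoeFun SmoothTorus (fun _ => ℝ → ℂ) := ⟨fun u => u.1⟩

theorem contDiff (u : SmoothTorus) : ContDiff ℝ ∞ u := u.2.1

theorem periodic (u : SmoothTorus) : Function.Periodic u 1 := u.2.2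

theorem coe_add (u v : SmoothTorus) : ((u + v : SmoothTorus) : ℝ → ℂ) = (u : ℝ → ℂ) + v := rfl

theorem coe_smul (c : ℂ) (u : SmoothTorus) : ((c • u : SmoothTorus) : ℝ → ℂ) = c • (u : ℝ → ℂ) :=
  rfl

/-- The derivative of a smooth periodic function. -/
def deriv (u : SmoothTorus) : SmoothTorus :=
  ⟨_root_.deriv u, by
    refine ⟨(contDiff_infty_iff_deriv.1 u.contDiff).2, fun x => ?_⟩
    have h : (fun y => u (y + 1)) = u := funext u.periodic
    rw [← deriv_comp_add_const, h]⟩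

theorem bddAbove_norm (u : SmoothTorus) : BddAbove (Set.range fun x : ℝ => ‖u x‖) := by
  obtain ⟨C, hC⟩ := (isCompact_Icc (a := (0 : ℝ)) (b := 1)).exists_bound_of_continuousOn
    u.contDiff.continuous.continuousOn
  refine ⟨C, ?_⟩
  rintro _ ⟨x, rfl⟩
  have h := u.periodic.sub_zsmul_eq ⌊x⌋ (x := x)
  simp only [zsmul_eq_mul, mul_one] at h
  show ‖u x‖ ≤ C
  rw [← h]
  exact hC _ ⟨by linarith [Int.floor_le x], by linarith [Int.lt_floor_add_one x]⟩

theorem iterate_deriv_coe (n : ℕ) (u : SmoothTorus) :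
    ((deriv^[n] u : SmoothTorus) : ℝ → ℂ) = iteratedDeriv n u := by
  induction n with
  | zero => simp
  | succ n ih =>
    rw [Function.iterate_succ_apply', iteratedDeriv_succ, ← ih]
    rfl

theorem bddAbove_iteratedDeriv (n : ℕ) (u : SmoothTorus) :
    BddAbove (Set.range fun x : ℝ => ‖iteratedDeriv n u x‖) := by
  have := bddAbove_norm (deriv^[n] u)
  rwa [iterate_deriv_coe] at this

/-- The seminorms `u ↦ sup |u⁽ⁿ⁾|`, `n ∈ ℕ`. -/
def supSeminorm (n : ℕ) : Seminorm ℂ SmoothTorus :=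
  Seminorm.of (fun u => ⨆ x : ℝ, ‖iteratedDeriv n u x‖)
    (fun u v => by
      refine ciSup_le fun x => ?_
      have h : iteratedDeriv n ((u + v : SmoothTorus) : ℝ → ℂ) x
          = iteratedDeriv n u x + iteratedDeriv n v x :=
        iteratedDeriv_add ((u.contDiff.of_le (by exact_mod_cast le_top)).contDiffAt)
          ((v.contDiff.of_le (by exact_mod_cast le_top)).contDiffAt)
      rw [h]
      exact (norm_add_le _ _).trans (add_le_add (le_ciSup (bddAbove_iteratedDeriv n u) x)
        (le_ciSup (bddAbove_iteratedDeriv n v) x)))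
    (fun c u => by
      rw [Real.mul_iSup_of_nonneg (norm_nonneg c)]
      refine iSup_congr fun x => ?_
      have h : iteratedDeriv n ((c • u : SmoothTorus) : ℝ → ℂ) x = c • iteratedDeriv n u x :=
        iteratedDeriv_const_smul (u.contDiff.of_le (by exact_mod_cast le_top)).contDiffAt c
      rw [h, norm_smul])

theorem norm_iteratedDeriv_le (n : ℕ) (u : SmoothTorus) (x : ℝ) :
    ‖iteratedDeriv n u x‖ ≤ supSeminorm n u := le_ciSup (bddAbove_iteratedDeriv n u) x

/-- The usual Fréchet topology of `𝒮(𝕋)`. -/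
instance : TopologicalSpace SmoothTorus :=
  (SeminormFamily.moduleFilterBasis (𝕜 := ℂ) supSeminorm).topology

theorem withSeminorms : WithSeminorms (𝕜 := ℂ) supSeminorm := ⟨rfl⟩

instance : IsTopologicalAddGroup SmoothTorus := withSeminorms.topologicalAddGroup

instance : ContinuousSMul ℂ SmoothTorus := withSeminorms.continuousSMul

end SmoothTorus

/-- The space `𝒮'(𝕋)` of periodic generalized functions: the topological dual of `𝒮(𝕋)`. -/
abbrev GeneralizedFunction : Type := SmoothTorus →L[ℂ] ℂ

/-- `f ∈ 𝒮'(𝕋)` belongs to `𝒮(𝕋)`, i.e. it is the functional `u ↦ ∫₀¹ g u` for a smooth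
periodic function `g`. -/
def IsSmooth (f : GeneralizedFunction) : Prop :=
  ∃ g : SmoothTorus, ∀ u : SmoothTorus, f u = ∫ x in (0 : ℝ)..1, g x * u x

/-! ### Fourier series -/

/-- The function `e_k(x) = exp(2 π i k x)`. -/
def expFun (k : ℤ) (x : ℝ) : ℂ := Complex.exp (2 * Real.pi * Complex.I * k * x)

theorem hasDerivAt_expFun (k : ℤ) (x : ℝ) :
    HasDerivAt (expFun k) (2 * Real.pi * Complex.I * k * expFun k x) x := by
  have h : HasDerivAt (fun y : ℝ => 2 * Real.pi * Complex.I * k * (y : ℂ))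
      (2 * Real.pi * Complex.I * k) x := by
    simpa using (Complex.ofRealCLM.hasDerivAt (x := x)).const_mul
      (2 * Real.pi * Complex.I * (k : ℂ))
  have h2 := h.cexp
  rwa [mul_comm (Complex.exp _)] at h2

theorem contDiff_expFun (k : ℤ) : ContDiff ℝ ∞ (expFun k) := by
  unfold expFun
  exact (contDiff_const.mul Complex.ofRealCLM.contDiff).cexp

theorem norm_expFun (k : ℤ) (x : ℝ) : ‖expFun k x‖ = 1 := by
  have h : (2 * Real.pi * Complex.I * k * x : ℂ) = ((2 * Real.pi * k * x : ℝ) : ℂ) * Complex.I := by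
    push_cast; ring
  rw [expFun, h, Complex.norm_exp_ofReal_mul_I]

theorem periodic_expFun (k : ℤ) : Function.Periodic (expFun k) 1 := fun x => by
  have h : (2 * Real.pi * Complex.I * k * ((x + 1 : ℝ) : ℂ) : ℂ)
      = 2 * Real.pi * Complex.I * k * x + k * (2 * Real.pi * Complex.I) := by
    push_cast; ring
  rw [expFun, h, Complex.exp_periodic.int_mul k, expFun]

/-- `e_k` as an element of `𝒮(𝕋)`. -/
def expTorus (k : ℤ) : SmoothTorus := ⟨expFun k, contDiff_expFun k, periodic_expFun k⟩

/-- The Fourier coefficient `f̂_k = ⟨f, e_{-k}⟩`. -/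
def fourierCoef (f : GeneralizedFunction) (k : ℤ) : ℂ := f (expTorus (-k))

/-- The pairing `⟨e_k, u⟩ = ∫₀¹ e_k u`. -/
def expPairing (k : ℤ) (u : SmoothTorus) : ℂ := ∫ x in (0 : ℝ)..1, expFun k x * u x

theorem intervalIntegrable_expPairing (k : ℤ) (u : SmoothTorus) :
    IntervalIntegrable (fun x => expFun k x * u x) MeasureTheory.volume 0 1 :=
  ((contDiff_expFun k).continuous.mul u.contDiff.continuous).intervalIntegrable _ _

theorem expPairing_add (k : ℤ) (u v : SmoothTorus) :
    expPairing k (u + v) = expPairing k u + expPairing k v := by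
  simp only [expPairing, SmoothTorus.coe_add, Pi.add_apply, mul_add]
  exact intervalIntegral.integral_add (intervalIntegrable_expPairing k u)
    (intervalIntegrable_expPairing k v)

theorem expPairing_smul (k : ℤ) (c : ℂ) (u : SmoothTorus) :
    expPairing k (c • u) = c * expPairing k u := by
  simp only [expPairing, SmoothTorus.coe_smul, Pi.smul_apply, smul_eq_mul]
  rw [← intervalIntegral.integral_const_mul]
  congr 1
  ext x
  ring

theorem expPairing_deriv (k : ℤ) (u : SmoothTorus) :
    expPairing k u.deriv = -(2 * Real.pi * Complex.I * k) * expPairing k u := by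
  have hu : ∀ x, HasDerivAt u (u.deriv x) x := fun x =>
    ((u.contDiff.differentiable (by simp)) x).hasDerivAt
  have h := intervalIntegral.integral_mul_deriv_eq_deriv_mul (a := 0) (b := 1)
    (fun x _ => hasDerivAt_expFun k x) (fun x _ => hu x)
    ((continuous_const.mul (contDiff_expFun k).continuous).intervalIntegrable _ _)
    (u.deriv.contDiff.continuous.intervalIntegrable _ _)
  have h1 : u 1 = u 0 := by simpa using u.periodic 0
  have h2 : expFun k 1 = expFun k 0 := by simpa using periodic_expFun k 0
  rw [h1, h2, sub_self, zero_sub] at h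
  rw [expPairing, h, expPairing, ← intervalIntegral.integral_const_mul,
    ← intervalIntegral.integral_neg]
  congr 1
  ext x
  ring

theorem expPairing_iterate_deriv (k : ℤ) (n : ℕ) (u : SmoothTorus) :
    expPairing k (SmoothTorus.deriv^[n] u)
      = (-(2 * Real.pi * Complex.I * k)) ^ n * expPairing k u := by
  induction n with
  | zero => simp
  | succ n ih =>
    rw [Function.iterate_succ_apply', expPairing_deriv, ih]
    ring

theorem norm_expPairing_pow_le (k : ℤ) (n : ℕ) (u : SmoothTorus) :
    (2 * Real.pi * |(k : ℝ)|) ^ n * ‖expPairing k u‖ ≤ SmoothTorus.supSeminorm n u := by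
  have h : (2 * Real.pi * |(k : ℝ)|) ^ n * ‖expPairing k u‖
      = ‖expPairing k (SmoothTorus.deriv^[n] u)‖ := by
    rw [expPairing_iterate_deriv, norm_mul, norm_pow]
    congr 2
    simp [abs_of_pos Real.pi_pos]
  rw [h, expPairing]
  have h2 := intervalIntegral.norm_integral_le_of_norm_le_const (a := 0) (b := 1)
    (f := fun x => expFun k x * (SmoothTorus.deriv^[n] u) x)
    (C := SmoothTorus.supSeminorm n u) (fun x _ => by
      rw [norm_mul, norm_expFun, one_mul, SmoothTorus.iterate_deriv_coe]
      exact SmoothTorus.norm_iteratedDeriv_le n u x)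
  simpa using h2

theorem norm_expPairing_le (k : ℤ) (N : ℕ) (u : SmoothTorus) :
    (1 + (k : ℝ) ^ 2) ^ N * ‖expPairing k u‖
      ≤ SmoothTorus.supSeminorm 0 u + SmoothTorus.supSeminorm (2 * N) u := by
  rcases eq_or_ne k 0 with rfl | hk
  · have h0 := norm_expPairing_pow_le 0 0 u
    have h1 : 0 ≤ SmoothTorus.supSeminorm (2 * N) u := apply_nonneg _ _
    simp only [pow_zero, one_mul] at h0
    simp only [Int.cast_zero, ne_eq, OfNat.ofNat_ne_zero, not_false_eq_true, zero_pow, add_zero,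
      one_pow, one_mul]
    linarith
  · have h0 := norm_expPairing_pow_le k (2 * N) u
    have h1 : 0 ≤ SmoothTorus.supSeminorm 0 u := apply_nonneg _ _
    have hk1 : (1 : ℝ) ≤ (k : ℝ) ^ 2 := by
      have : (1 : ℤ) ≤ k ^ 2 := by have := sq_pos_of_ne_zero hk; omega
      exact_mod_cast this
    have h2 : (1 + (k : ℝ) ^ 2) ^ N ≤ (2 * Real.pi * |(k : ℝ)|) ^ (2 * N) := by
      rw [pow_mul]
      refine pow_le_pow_left₀ (by positivity) ?_ N
      rw [mul_pow, sq_abs]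
      have h4 : (2 : ℝ) ≤ (2 * Real.pi) ^ 2 := by nlinarith [Real.pi_gt_three]
      nlinarith
    have h3 := mul_le_mul_of_nonneg_right h2 (norm_nonneg (expPairing k u))
    linarith

theorem summable_one_add_sq_inv : Summable fun k : ℤ => (1 + (k : ℝ) ^ 2)⁻¹ := by
  have h : Summable fun k : ℤ => 1 / (k : ℝ) ^ 2 := Real.summable_one_div_int_pow.2 one_lt_two
  refine h.of_norm_bounded_eventually ?_
  have : ∀ᶠ k : ℤ in Filter.cofinite, k ≠ 0 :=
    (Set.finite_singleton (0 : ℤ)).eventually_cofinite_notMem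
  filter_upwards [this] with k hk
  have hk1 : (0 : ℝ) < (k : ℝ) ^ 2 := by positivity
  rw [Real.norm_of_nonneg (by positivity), one_div]
  exact inv_anti₀ hk1 (by linarith)

/-- At most polynomial growth of a family of coefficients. -/
def PolyBounded (a : ℤ → ℂ) : Prop :=
  ∃ (C : ℝ) (N : ℕ), ∀ k : ℤ, ‖a k‖ ≤ C * (1 + (k : ℝ) ^ 2) ^ N

theorem norm_term_le {a : ℤ → ℂ} {C : ℝ} {N : ℕ}
    (h : ∀ k : ℤ, ‖a k‖ ≤ C * (1 + (k : ℝ) ^ 2) ^ N) (u : SmoothTorus) (k : ℤ) :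
    ‖a k * expPairing k u‖ ≤
      C * (SmoothTorus.supSeminorm 0 u + SmoothTorus.supSeminorm (2 * (N + 1)) u)
        * (1 + (k : ℝ) ^ 2)⁻¹ := by
  have hC : 0 ≤ C := by simpa using (norm_nonneg _).trans (h 0)
  have hpos : (0 : ℝ) < 1 + (k : ℝ) ^ 2 := by positivity
  rw [← div_eq_mul_inv, le_div_iff₀ hpos, norm_mul]
  calc ‖a k‖ * ‖expPairing k u‖ * (1 + (k : ℝ) ^ 2)
      ≤ C * (1 + (k : ℝ) ^ 2) ^ N * ‖expPairing k u‖ * (1 + (k : ℝ) ^ 2) := by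
        gcongr; exact h k
    _ = C * ((1 + (k : ℝ) ^ 2) ^ (N + 1) * ‖expPairing k u‖) := by ring
    _ ≤ _ := by gcongr; exact norm_expPairing_le k (N + 1) u

theorem summable_term {a : ℤ → ℂ} (h : PolyBounded a) (u : SmoothTorus) :
    Summable fun k : ℤ => a k * expPairing k u := by
  obtain ⟨C, N, h⟩ := h
  exact (summable_one_add_sq_inv.mul_left _).of_norm_bounded (norm_term_le h u)

/-- The linear functional `u ↦ ∑_{k ∈ ℤ} a_k ⟨e_k, u⟩`. -/
def fourierSeriesLinear (a : ℤ → ℂ) (h : PolyBounded a) : SmoothTorus →ₗ[ℂ] ℂ where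
  toFun := fun u => ∑' k : ℤ, a k * expPairing k u
  map_add' := fun u v => by
    simp only [expPairing_add, mul_add]
    exact (summable_term h u).tsum_add (summable_term h v)
  map_smul' := fun c u => by
    simp only [expPairing_smul, RingHom.id_apply, smul_eq_mul]
    rw [← tsum_mul_left]
    congr 1
    ext k
    ring

theorem continuous_fourierSeriesLinear (a : ℤ → ℂ) (h : PolyBounded a) :
    Continuous (fourierSeriesLinear a h) := by
  obtain ⟨C, N, hC⟩ := id h
  have hC0 : 0 ≤ C := by simpa using (norm_nonneg _).trans (hC 0)
  have hbound : ∀ u : SmoothTorus, ‖fourierSeriesLinear a h u‖ ≤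
      (C * ∑' k : ℤ, (1 + (k : ℝ) ^ 2)⁻¹) *
        (SmoothTorus.supSeminorm 0 u + SmoothTorus.supSeminorm (2 * (N + 1)) u) := fun u => by
    have h1 := tsum_of_norm_bounded (summable_one_add_sq_inv.mul_left
      (C * (SmoothTorus.supSeminorm 0 u + SmoothTorus.supSeminorm (2 * (N + 1)) u))).hasSum
      (norm_term_le hC u)
    rw [tsum_mul_left] at h1
    exact h1.trans (le_of_eq (by ring))
  have hcont : Continuous fun u : SmoothTorus => (C * ∑' k : ℤ, (1 + (k : ℝ) ^ 2)⁻¹) *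
      (SmoothTorus.supSeminorm 0 u + SmoothTorus.supSeminorm (2 * (N + 1)) u) :=
    continuous_const.mul ((SmoothTorus.withSeminorms.continuous_seminorm 0).add
      (SmoothTorus.withSeminorms.continuous_seminorm (2 * (N + 1))))
  refine continuous_of_continuousAt_zero (fourierSeriesLinear a h) ?_
  rw [ContinuousAt, map_zero]
  refine squeeze_zero_norm hbound ?_
  have := hcont.tendsto 0
  simpa using this

/-- The generalized function `∑_{k ∈ ℤ} a_k e_k`, for coefficients `a` of at most polynomial
growth. -/
def fourierSeries (a : ℤ → ℂ) (h : PolyBounded a) : GeneralizedFunction :=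
  ⟨fourierSeriesLinear a h, continuous_fourierSeriesLinear a h⟩

theorem iteratedDeriv_expFun (k : ℤ) (n : ℕ) :
    iteratedDeriv n (expFun k) = fun x => (2 * Real.pi * Complex.I * k) ^ n * expFun k x := by
  induction n with
  | zero => simp
  | succ n ih =>
    rw [iteratedDeriv_succ, ih]
    ext x
    rw [((hasDerivAt_expFun k x).const_mul _).deriv]
    ring

theorem polyBounded_fourierCoef (f : GeneralizedFunction) : PolyBounded (fourierCoef f) := by
  obtain ⟨s, C, -, hC⟩ := Seminorm.bound_of_continuous SmoothTorus.withSeminorms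
    ((normSeminorm ℂ ℂ).comp f.toLinearMap) (continuous_norm.comp f.continuous)
  refine ⟨C * (2 * Real.pi) ^ (s.sup id), s.sup id, fun k => ?_⟩
  have h1 : ‖fourierCoef f k‖ ≤ C * (s.sup SmoothTorus.supSeminorm) (expTorus (-k)) :=
    hC (expTorus (-k))
  refine h1.trans ?_
  rw [mul_assoc]
  refine mul_le_mul_of_nonneg_left ?_ C.2
  refine Seminorm.finset_sup_apply_le (by positivity) fun n hn => ?_
  refine ciSup_le fun x => ?_
  have h2 : iteratedDeriv n (expTorus (-k)) x
      = (2 * Real.pi * Complex.I * ((-k : ℤ) : ℂ)) ^ n * expFun (-k) x :=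
    congrFun (iteratedDeriv_expFun (-k) n) x
  have h3 : n ≤ s.sup id := Finset.le_sup (f := id) hn
  have h4 : ‖(2 * Real.pi * Complex.I * ((-k : ℤ) : ℂ))‖ = 2 * Real.pi * |(k : ℝ)| := by
    simp [abs_of_pos Real.pi_pos]
  rw [h2, norm_mul, norm_pow, norm_expFun, mul_one, h4, ← mul_pow]
  have h5 : |(k : ℝ)| ≤ 1 + (k : ℝ) ^ 2 := by
    rw [← sq_abs]; nlinarith [sq_nonneg (|(k : ℝ)| - 1), abs_nonneg (k : ℝ)]
  have h6 : (1 : ℝ) ≤ 2 * Real.pi * (1 + (k : ℝ) ^ 2) := by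
    nlinarith [Real.pi_gt_three, sq_nonneg (k : ℝ)]
  calc (2 * Real.pi * |(k : ℝ)|) ^ n ≤ (2 * Real.pi * (1 + (k : ℝ) ^ 2)) ^ n := by gcongr
    _ ≤ _ := pow_le_pow_right₀ h6 h3

theorem polyBounded_sobolev (γ : ℝ) (f : GeneralizedFunction) :
    PolyBounded fun k => (((1 + (k : ℝ) ^ 2) ^ (γ / 2) : ℝ) : ℂ) * fourierCoef f k := by
  obtain ⟨C, N, h⟩ := polyBounded_fourierCoef f
  have hC : 0 ≤ C := by simpa using (norm_nonneg _).trans (h 0)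
  refine ⟨C, N + ⌈|γ|⌉₊, fun k => ?_⟩
  have h1 : (1 : ℝ) ≤ 1 + (k : ℝ) ^ 2 := by nlinarith [sq_nonneg (k : ℝ)]
  have h2 : (1 + (k : ℝ) ^ 2) ^ (γ / 2) ≤ (1 + (k : ℝ) ^ 2) ^ ⌈|γ|⌉₊ := by
    rw [← Real.rpow_natCast (1 + (k : ℝ) ^ 2)]
    refine Real.rpow_le_rpow_of_exponent_le h1 ?_
    have := Nat.le_ceil |γ|
    have := le_abs_self γ
    have := abs_nonneg γ
    linarith
  rw [norm_mul, Complex.norm_real, Real.norm_of_nonneg (by positivity), pow_add]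
  calc _ ≤ (1 + (k : ℝ) ^ 2) ^ ⌈|γ|⌉₊ * (C * (1 + (k : ℝ) ^ 2) ^ N) := by
        gcongr; exact h k
    _ = _ := by ring

/-- The Sobolev operator `L_γ f = ∑_{k ∈ ℤ} (1 + k²)^{γ/2} f̂_k e_k`. -/
def sobolevOp (γ : ℝ) (f : GeneralizedFunction) : GeneralizedFunction :=
  fourierSeries (fun k => (((1 + (k : ℝ) ^ 2) ^ (γ / 2) : ℝ) : ℂ) * fourierCoef f k)
    (polyBounded_sobolev γ f)

/-! ### Periodic Besov spaces -/

/-- The functions `φ_0` and `φ_j = φ(2^{-j} ·)` for `j ≥ 1`. -/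
def dyadicFun (φ₀ φ : ℝ → ℝ) (j : ℕ) (x : ℝ) : ℝ :=
  if j = 0 then φ₀ x else φ (x / 2 ^ j)

/-- A smooth dyadic resolution of unity `(φ_j)_{j ≥ 0}`, generated by `φ_0` and `φ`. -/
structure DyadicSystem where
  φ₀ : 𝓢(ℝ, ℝ)
  φ : 𝓢(ℝ, ℝ)
  nonneg₀ : ∀ x, 0 ≤ φ₀ x
  nonneg : ∀ x, 0 ≤ φ x
  support₀ : tsupport φ₀ ⊆ {x | |x| ≤ 2}
  support : tsupport φ ⊆ {x | 1 / 2 ≤ |x| ∧ |x| ≤ 2}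
  hasSum_one : ∀ x, HasSum (fun j : ℕ => dyadicFun φ₀ φ j x) 1

/-- Dyadic resolutions of unity exist. -/
theorem DyadicSystem.nonempty : Nonempty DyadicSystem := by
  let b : ContDiffBump (0 : ℝ) := ⟨1, 2, one_pos, one_lt_two⟩
  have hb1 : ∀ x : ℝ, |x| ≤ 1 → b x = 1 := fun x hx =>
    b.one_of_mem_closedBall (by simpa [b] using hx)
  have hb0 : ∀ x : ℝ, 2 ≤ |x| → b x = 0 := fun x hx =>
    b.zero_of_le_dist (by simpa [b] using hx)
  have hbs : ∀ x : ℝ, b x ≠ 0 → |x| ≤ 2 := fun x hx => by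
    by_contra h
    exact hx (hb0 x (by linarith))
  let g : ℝ → ℝ := fun x => b x - b (2 * x)
  have hg : ∀ x, g x ≠ 0 → 1 / 2 ≤ |x| ∧ |x| ≤ 2 := fun x hx => by
    constructor
    · by_contra h
      have h2 : |2 * x| ≤ 1 := by rw [abs_mul, abs_two]; linarith
      exact hx (by simp [g, hb1 x (by linarith), hb1 _ h2])
    · by_contra h
      have h2 : 2 ≤ |2 * x| := by rw [abs_mul, abs_two]; linarith
      exact hx (by simp [g, hb0 x (by linarith), hb0 _ h2])
  have hcl : IsClosed {x : ℝ | 1 / 2 ≤ |x| ∧ |x| ≤ 2} :=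
    (isClosed_le continuous_const continuous_abs).inter
      (isClosed_le continuous_abs continuous_const)
  have hts : tsupport g ⊆ {x | 1 / 2 ≤ |x| ∧ |x| ≤ 2} := closure_minimal hg hcl
  have hgc : HasCompactSupport g :=
    HasCompactSupport.intro (isCompact_Icc (a := (-2 : ℝ)) (b := 2)) fun x hx => by
      by_contra h
      exact hx (abs_le.1 (hg x h).2)
  have hgs : ContDiff ℝ ∞ g := b.contDiff.sub (b.contDiff.comp (contDiff_const.mul contDiff_id))
  have hgn : ∀ x, 0 ≤ g x := fun x => by
    rcases le_total |x| 1 with h | h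
    · simp only [g, hb1 x h]; linarith [b.le_one (x := 2 * x)]
    · have h2 : 2 ≤ |2 * x| := by rw [abs_mul, abs_two]; linarith
      simp only [g, hb0 _ h2]; linarith [b.nonneg (x := x)]
  refine ⟨b.hasCompactSupport.toSchwartzMap b.contDiff, hgc.toSchwartzMap hgs,
    fun x => b.nonneg, hgn, closure_minimal hbs (isClosed_le continuous_abs continuous_const),
    hts, fun x => ?_⟩
  have hpart : ∀ n : ℕ, ∑ j ∈ Finset.range (n + 1), dyadicFun b g j x = b (x / 2 ^ n) := by
    intro n
    induction n with
    | zero => simp [dyadicFun]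
    | succ n ih =>
      rw [Finset.sum_range_succ, ih]
      have h2 : 2 * (x / 2 ^ (n + 1)) = x / 2 ^ n := by rw [pow_succ]; field_simp
      simp [dyadicFun, g, h2]
  have hnn : ∀ j, 0 ≤ dyadicFun b g j x := fun j => by
    unfold dyadicFun
    split_ifs
    · exact b.nonneg
    · exact hgn _
  show HasSum (fun j : ℕ => dyadicFun b g j x) 1
  rw [hasSum_iff_tendsto_nat_of_nonneg hnn, ← Filter.tendsto_add_atTop_iff_nat 1]
  simp only [hpart]
  obtain ⟨N, hN⟩ := pow_unbounded_of_one_lt |x| one_lt_two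
  refine tendsto_const_nhds.congr' ?_
  filter_upwards [Filter.eventually_ge_atTop N] with n hn
  refine (hb1 _ ?_).symm
  rw [abs_div, abs_of_pos (by positivity : (0 : ℝ) < 2 ^ n), div_le_one (by positivity)]
  exact hN.le.trans (pow_le_pow_right₀ one_le_two hn)

/-- The dyadic block `∑_k φ_j(k) f̂_k e_k`; for every `j` the sum is finite. -/
def block (Φ : DyadicSystem) (f : GeneralizedFunction) (j : ℕ) (x : ℝ) : ℂ :=
  ∑' k : ℤ, (dyadicFun Φ.φ₀ Φ.φ j k : ℂ) * fourierCoef f k * expFun k x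

/-- The term `2^{js} ‖∑_k φ_j(k) f̂_k e_k‖_{L_p(𝕋)}`. -/
def blockNorm (Φ : DyadicSystem) (f : GeneralizedFunction) (s : ℝ) (p : ℝ≥0∞) (j : ℕ) : ℝ≥0∞ :=
  (2 : ℝ≥0∞) ^ (j * s : ℝ) *
    MeasureTheory.eLpNorm (block Φ f j) p (MeasureTheory.volume.restrict (Set.Ioc (0 : ℝ) 1))

/-- The Besov (quasi-)norm, with values in `[0, ∞]`. -/
def besovNorm (Φ : DyadicSystem) (f : GeneralizedFunction) (s : ℝ) (p q : ℝ≥0∞) : ℝ≥0∞ :=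
  if q = ⊤ then ⨆ j : ℕ, blockNorm Φ f s p j
  else (∑' j : ℕ, blockNorm Φ f s p j ^ q.toReal) ^ (1 / q.toReal)

/-- `f ∈ B_{p,q}^s(𝕋)`. -/
def MemBesov (Φ : DyadicSystem) (f : GeneralizedFunction) (s : ℝ) (p q : ℝ≥0∞) : Prop :=
  besovNorm Φ f s p q < ⊤

/-! ### The critical smoothness -/

/-- The `(p,q)`-critical smoothness `s_f(p,q)`. -/
def criticalSmoothnessPQ (Φ : DyadicSystem) (f : GeneralizedFunction) (p q : ℝ≥0∞) : EReal :=
  ⨆ (s : ℝ) (_ : MemBesov Φ f s p q), (s : EReal)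

/-- The critical smoothness `s_f(p) = s_f(p,p)`. -/
def criticalSmoothness (Φ : DyadicSystem) (f : GeneralizedFunction) (p : ℝ≥0∞) : EReal :=
  criticalSmoothnessPQ Φ f p p

/-- The number `1/p ∈ [0, ∞)` for `p ∈ (0, ∞]`. -/
def recip (p : ℝ≥0∞) : ℝ := (p⁻¹).toReal

/-- The function `1/p ↦ s_f(p)` of the real variable `t = 1/p ∈ [0, ∞)`. -/
def criticalFun (Φ : DyadicSystem) (f : GeneralizedFunction) (t : ℝ) : ℝ :=
  (criticalSmoothness Φ f (ENNReal.ofReal t)⁻¹).toReal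

/-- `1/p ↦ s_f(p)` has the left derivative `d` at `1/p₀`, where `p₀ ∈ (0, ∞)`. -/
def HasLeftDiff (Φ : DyadicSystem) (f : GeneralizedFunction) (p₀ : ℝ≥0∞) (d : ℝ) : Prop :=
  HasDerivWithinAt (criticalFun Φ f) d (Set.Iic (recip p₀)) (recip p₀)

/-- `1/p ↦ s_f(p)` has the right derivative `d` at `1/p₀`, where `p₀ ∈ (0, ∞]`. -/
def HasRightDiff (Φ : DyadicSystem) (f : GeneralizedFunction) (p₀ : ℝ≥0∞) (d : ℝ) : Prop :=
  HasDerivWithinAt (criticalFun Φ f) d (Set.Ici (recip p₀)) (recip p₀)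

end PeriodicBesov

end

open scoped ContDiff ENNReal SchwartzMap

noncomputable section

namespace PeriodicBesov

/-! ### Concave functions on the half-line with slopes in `[0, 1]` -/

section Concave

open Set Filter Topology

variable {g : ℝ → ℝ}

/-! Everything rests on three properties of `g = criticalFun Φ f`, that is, of `s_f(p)` as a
function of `t = 1/p ∈ [0, ∞)`. It is concave, because Lyapunov's inequality, applied to each dyadic
block, interpolates Besov conditions (`MemBesov.interpolate`). It is nondecreasing, because the
torus has measure one and the `L_p` norms increase with `p` (`MemBesov.mono_exponent`). It satisfies
`g t ≤ g 0 + t`, because a block is a trigonometric polynomial of degree at most `2 ^ (j + 1)`, and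
Nikol'skii's inequality passes from `L_p` to `L_∞` at the cost of a factor of order `2 ^ (j / p)`
(`MemBesov.sub_top`). Hence all slopes of `g` lie in `[0, 1]`. The one-sided derivatives, their
order, the countable exceptional set and the rigidity at the extremal slopes `1` and `0` are then
facts about concave functions.

The index `q` is immaterial: lowering `s` by any positive amount turns a bounded sequence of block
norms into a geometrically decaying one, so it suffices to work with `q = ∞`. The critical
smoothness is not `-∞` because Fourier coefficients grow at most polynomially (`exists_memBesov`).
It is not `+∞` because otherwise Nikol'skii's inequality would give every smoothness at `p = ∞`, the
coefficients would decay rapidly, and `f` would be smooth (`isSmooth_of_forall_memBesov`).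

For the Sobolev operator with `p < 1` allowed, convolution estimates are not available. On the
frequencies of block `j ≥ 1` the multiplier is `2 ^ (j * γ)` times a smooth periodic function of `k
/ 2 ^ (j + 3)`. Its Fourier series writes the new block as a superposition of translates of the old
one, with coefficients decaying rapidly and uniformly in `j` (`hasSum_block_sobolevOp`,
`eLpNorm_le_of_hasSum_translates`). The reverse inequality comes from the inverse operator. -/

theorem slope_nonneg_of_monotoneOn (hm : MonotoneOn g (Ici 0)) {x y : ℝ} (hx : 0 ≤ x)
    (hxy : x < y) : 0 ≤ slope g x y := by
  rw [slope_def_field]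
  exact div_nonneg (sub_nonneg.2 (hm hx (hx.trans hxy.le) hxy.le)) (sub_nonneg.2 hxy.le)

/-- Only chords from `0` are bounded by hypothesis; concavity carries the bound to all others, since
the chord from `x` to `y` is no steeper than the one from `0` to `x`. -/
theorem slope_le_one_of_concaveOn (hc : ConcaveOn ℝ (Ici 0) g) (h1 : ∀ t, 0 ≤ t → g t ≤ g 0 + t)
    {x y : ℝ} (hx : 0 ≤ x) (hxy : x < y) : slope g x y ≤ 1 := by
  have key : ∀ z, 0 < z → slope g 0 z ≤ 1 := fun z hz => by
    rw [slope_def_field, sub_zero, div_le_one hz]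
    linarith [h1 z hz.le]
  rcases hx.eq_or_lt with rfl | hx'
  · exact key y hxy
  · refine le_trans ?_ (key x hx')
    rw [slope_comm g 0 x]
    exact hc.slope_anti hx ⟨self_mem_Ici, hx'.ne⟩
      ⟨hx.trans hxy.le, hxy.ne'⟩ (hx'.trans hxy).le

/-- The endpoint `t = 0` is included, where concavity alone would allow an infinite derivative. The
chord slopes increase as the right end approaches `t`, and the bound `1` makes their limit finite.
-/
theorem exists_hasDerivWithinAt_Ici (hc : ConcaveOn ℝ (Ici 0) g)
    (h1 : ∀ t, 0 ≤ t → g t ≤ g 0 + t) {t : ℝ} (ht : 0 ≤ t) :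
    ∃ d, HasDerivWithinAt g d (Ici t) t := by
  have hmono : AntitoneOn (slope g t) (Ioo t (t + 1)) :=
    (hc.antitoneOn_slope_gt ht).mono fun z hz => ⟨ht.trans hz.1.le, hz.1⟩
  have hb : BddAbove (slope g t '' Ioo t (t + 1)) := by
    refine ⟨1, ?_⟩
    rintro _ ⟨z, hz, rfl⟩
    exact slope_le_one_of_concaveOn hc h1 ht hz.1
  have h := hmono.tendsto_nhdsWithin_Ioo_right (by simp) hb
  exact ⟨_, ((hasDerivWithinAt_iff_tendsto_slope' self_notMem_Ioi).2 h).Ici_of_Ioi⟩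

theorem exists_hasDerivWithinAt_Iic (hc : ConcaveOn ℝ (Ici 0) g) {t : ℝ} (ht : 0 < t) :
    ∃ d, HasDerivWithinAt g d (Iic t) t := by
  have hint : t ∈ interior (Ici (0 : ℝ)) := by simpa using ht
  have h := (hc.neg.hasDerivWithinAt_sSup_slope_of_mem_interior hint).neg
  rw [neg_neg] at h
  exact ⟨_, h.Iic_of_Iio⟩

theorem right_le_left_of_hasDerivWithinAt (hc : ConcaveOn ℝ (Ici 0) g) {t dl dr : ℝ} (ht : 0 < t)
    (hl : HasDerivWithinAt g dl (Iic t) t) (hr : HasDerivWithinAt g dr (Ici t) t) : dr ≤ dl := by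
  have hint : t ∈ interior (Ici (0 : ℝ)) := by simpa using ht
  have h := hc.neg.leftDeriv_le_rightDeriv_of_mem_interior hint
  rw [(hl.mono Iio_subset_Iic_self).neg.derivWithin (uniqueDiffWithinAt_Iio t),
    (hr.mono Ioi_subset_Ici_self).neg.derivWithin (uniqueDiffWithinAt_Ioi t)] at h
  exact neg_le_neg_iff.1 h

theorem left_le_right_of_lt (hc : ConcaveOn ℝ (Ici 0) g) {t t' dl dr : ℝ} (ht : 0 ≤ t)
    (htt : t < t') (hl : HasDerivWithinAt g dl (Iic t') t')
    (hr : HasDerivWithinAt g dr (Ici t) t) : dl ≤ dr :=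
  (hc.le_slope_of_hasDerivWithinAt_Iio ht (ht.trans htt.le : (0 : ℝ) ≤ t') htt
    (hl.mono Iio_subset_Iic_self)).trans
  (hc.slope_le_of_hasDerivWithinAt_Ioi ht (ht.trans htt.le : (0 : ℝ) ≤ t') htt
    (hr.mono Ioi_subset_Ici_self))

/-- A point of non-differentiability leaves a gap between the right and the left derivative. By
concavity these gaps are disjoint and ordered, so a rational chosen in each one gives an injection
into `ℚ`. -/
theorem countable_not_differentiableWithinAt (hc : ConcaveOn ℝ (Ici 0) g)
    (h1 : ∀ t, 0 ≤ t → g t ≤ g 0 + t) :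
    {t : ℝ | 0 ≤ t ∧ ¬ DifferentiableWithinAt ℝ g (Ici 0) t}.Countable := by
  have key : ∀ t ∈ {t : ℝ | 0 ≤ t ∧ ¬ DifferentiableWithinAt ℝ g (Ici 0) t},
      ∃ (q : ℚ) (dl dr : ℝ), HasDerivWithinAt g dl (Iic t) t ∧
        HasDerivWithinAt g dr (Ici t) t ∧ dr < q ∧ (q : ℝ) < dl := by
    rintro t ⟨ht, hd⟩
    obtain ⟨dr, hr⟩ := exists_hasDerivWithinAt_Ici hc h1 ht
    rcases ht.eq_or_lt with rfl | ht'
    · exact absurd hr.differentiableWithinAt hd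
    obtain ⟨dl, hl⟩ := exists_hasDerivWithinAt_Iic hc ht'
    have hle := right_le_left_of_hasDerivWithinAt hc ht' hl hr
    have hne : dr ≠ dl := by
      rintro rfl
      have := hl.union hr
      rw [Iic_union_Ici, hasDerivWithinAt_univ] at this
      exact hd this.differentiableAt.differentiableWithinAt
    obtain ⟨q, hq1, hq2⟩ := exists_rat_btwn (lt_of_le_of_ne hle hne)
    exact ⟨q, dl, dr, hl, hr, hq1, hq2⟩
  choose! q dl dr hl hr hq1 hq2 using key
  have hanti : ∀ t ∈ {t : ℝ | 0 ≤ t ∧ ¬ DifferentiableWithinAt ℝ g (Ici 0) t},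
      ∀ t' ∈ {t : ℝ | 0 ≤ t ∧ ¬ DifferentiableWithinAt ℝ g (Ici 0) t}, t < t' → q t' < q t :=
    fun t ht t' ht' h => by
      have := left_le_right_of_lt hc ht.1 h (hl t' ht') (hr t ht)
      have h2 := hq1 t ht
      have h3 := hq2 t' ht'
      exact_mod_cast (h3.trans_le this).trans h2
  refine MapsTo.countable_of_injOn (f := q) (t := univ) (fun _ _ => mem_univ _) ?_ countable_univ
  intro t ht t' ht' h
  rcases lt_trichotomy t t' with hlt | heq | hlt
  · exact absurd h (hanti t ht t' ht' hlt).ne'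
  · exact heq
  · exact absurd h (hanti t' ht' t ht hlt).ne

/-- The chord from `t` to `t₀` has slope at least the left derivative at `t₀`, which is `1`, and no
slope exceeds `1`. -/
theorem eq_add_sub_of_hasDerivWithinAt_one (hc : ConcaveOn ℝ (Ici 0) g)
    (h1 : ∀ t, 0 ≤ t → g t ≤ g 0 + t) {t₀ t : ℝ} (ht : 0 ≤ t) (htt : t ≤ t₀)
    (hl : HasDerivWithinAt g 1 (Iic t₀) t₀) : g t = g t₀ + (t - t₀) := by
  rcases htt.eq_or_lt with rfl | htt
  · simp
  have ha := hc.le_slope_of_hasDerivWithinAt_Iio ht (ht.trans htt.le : (0 : ℝ) ≤ t₀) htt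
    (hl.mono Iio_subset_Iic_self)
  have hb := slope_le_one_of_concaveOn hc h1 ht htt
  have hs : slope g t t₀ = 1 := le_antisymm hb ha
  rw [slope_def_field, div_eq_one_iff_eq (sub_pos.2 htt).ne'] at hs
  linarith

theorem eq_of_hasDerivWithinAt_zero (hc : ConcaveOn ℝ (Ici 0) g) (hm : MonotoneOn g (Ici 0))
    {t₀ t : ℝ} (ht : 0 ≤ t₀) (htt : t₀ ≤ t)
    (hr : HasDerivWithinAt g 0 (Ici t₀) t₀) : g t = g t₀ := by
  rcases htt.eq_or_lt with rfl | htt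
  · rfl
  have ha := hc.slope_le_of_hasDerivWithinAt_Ioi ht (ht.trans htt.le : (0 : ℝ) ≤ t) htt
    (hr.mono Ioi_subset_Ici_self)
  have hs : slope g t₀ t = 0 := le_antisymm ha (slope_nonneg_of_monotoneOn hm ht htt)
  rw [slope_def_field, div_eq_zero_iff] at hs
  rcases hs with hs | hs <;> linarith

end Concave

/-! ### Dyadic blocks -/

section Blocks

open MeasureTheory

/-- Lebesgue measure on the period `(0, 1]`. -/
abbrev torusVol : Measure ℝ := volume.restrict (Set.Ioc (0 : ℝ) 1)

instance isProbabilityMeasure_torusVol : IsProbabilityMeasure torusVol :=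
  ⟨by simp [torusVol]⟩

variable (Φ : DyadicSystem) (f : GeneralizedFunction)

theorem dyadicFun_nonneg (j : ℕ) (x : ℝ) : 0 ≤ dyadicFun Φ.φ₀ Φ.φ j x := by
  unfold dyadicFun
  split_ifs
  · exact Φ.nonneg₀ x
  · exact Φ.nonneg _

theorem dyadicFun_le_one (j : ℕ) (x : ℝ) : dyadicFun Φ.φ₀ Φ.φ j x ≤ 1 :=
  le_hasSum (Φ.hasSum_one x) j fun i _ => dyadicFun_nonneg Φ i x

theorem abs_le_of_dyadicFun_ne_zero {j : ℕ} {x : ℝ} (h : dyadicFun Φ.φ₀ Φ.φ j x ≠ 0) :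
    |x| ≤ 2 ^ (j + 1) := by
  unfold dyadicFun at h
  split_ifs at h with hj
  · subst hj
    simpa using Φ.support₀ (subset_tsupport _ h)
  · have := (Φ.support (subset_tsupport _ h)).2
    rw [abs_div, abs_of_pos (by positivity : (0 : ℝ) < 2 ^ j), div_le_iff₀ (by positivity)] at this
    rw [pow_succ]
    linarith

theorem le_abs_of_dyadicFun_ne_zero {j : ℕ} (hj : j ≠ 0) {x : ℝ}
    (h : dyadicFun Φ.φ₀ Φ.φ j x ≠ 0) : 2 ^ j ≤ 2 * |x| := by
  unfold dyadicFun at h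
  rw [if_neg hj] at h
  have := (Φ.support (subset_tsupport _ h)).1
  rw [abs_div, abs_of_pos (by positivity : (0 : ℝ) < 2 ^ j), le_div_iff₀ (by positivity)] at this
  linarith

theorem dyadicFun_eq_zero {j : ℕ} {k : ℤ}
    (hk : k ∉ Finset.Icc (-2 ^ (j + 1) : ℤ) (2 ^ (j + 1))) : dyadicFun Φ.φ₀ Φ.φ j k = 0 := by
  by_contra h
  have := abs_le_of_dyadicFun_ne_zero Φ h
  have h2 : |k| ≤ 2 ^ (j + 1) := by exact_mod_cast this
  exact hk (Finset.mem_Icc.2 (abs_le.1 h2))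

theorem block_eq_sum (j : ℕ) (x : ℝ) :
    block Φ f j x = ∑ k ∈ Finset.Icc (-2 ^ (j + 1) : ℤ) (2 ^ (j + 1)),
      (dyadicFun Φ.φ₀ Φ.φ j k : ℂ) * fourierCoef f k * expFun k x := by
  refine tsum_eq_sum fun k hk => ?_
  rw [dyadicFun_eq_zero Φ hk]
  simp

theorem continuous_block (j : ℕ) : Continuous (block Φ f j) := by
  rw [funext (block_eq_sum Φ f j)]
  exact continuous_finsetSum _ fun k _ => continuous_const.mul (contDiff_expFun k).continuous

theorem aestronglyMeasurable_block (j : ℕ) : AEStronglyMeasurable (block Φ f j) torusVol :=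
  (continuous_block Φ f j).aestronglyMeasurable

/-! ### Dependence of the Besov condition on the parameters -/

variable {Φ f}

theorem memBesov_top_iff {s : ℝ} {p : ℝ≥0∞} :
    MemBesov Φ f s p ⊤ ↔ ∃ C : ℝ≥0∞, C ≠ ⊤ ∧ ∀ j, blockNorm Φ f s p j ≤ C := by
  simp only [MemBesov, besovNorm, if_true]
  exact ⟨fun h => ⟨_, h.ne, fun j => le_iSup (fun j => blockNorm Φ f s p j) j⟩,
    fun ⟨C, hC, h⟩ => (iSup_le h).trans_lt hC.lt_top⟩

theorem MemBesov.to_top {s : ℝ} {p q : ℝ≥0∞} (hq : 0 < q) (h : MemBesov Φ f s p q) :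
    MemBesov Φ f s p ⊤ := by
  by_cases hqt : q = ⊤
  · rwa [hqt] at h
  have hq' : 0 < q.toReal := ENNReal.toReal_pos hq.ne' hqt
  rw [MemBesov, besovNorm, if_neg hqt] at h
  refine memBesov_top_iff.2 ⟨_, h.ne, fun j => ?_⟩
  rw [one_div, ENNReal.le_rpow_inv_iff hq']
  exact ENNReal.le_tsum j

theorem blockNorm_add (s r : ℝ) (p : ℝ≥0∞) (j : ℕ) :
    blockNorm Φ f (s + r) p j = ((2 : ℝ≥0∞) ^ r) ^ j * blockNorm Φ f s p j := by
  rw [blockNorm, blockNorm, ← mul_assoc, ← ENNReal.rpow_natCast, ← ENNReal.rpow_mul,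
    ← ENNReal.rpow_add _ _ (by simp) (by simp)]
  congr 2
  ring

/-- The loss `s - s'` contributes the factor `2 ^ (j * (s' - s))`, which is summable to every
positive power `q`. -/
theorem MemBesov.of_top {s s' : ℝ} {p q : ℝ≥0∞} (hq : 0 < q) (hs : s' < s)
    (h : MemBesov Φ f s p ⊤) : MemBesov Φ f s' p q := by
  obtain ⟨C, hC, hb⟩ := memBesov_top_iff.1 h
  have hr : (2 : ℝ≥0∞) ^ (s' - s) < 1 := by
    have := ENNReal.rpow_lt_rpow_of_exponent_lt (x := 2) (by norm_num) (by simp) (sub_neg.2 hs)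
    simpa using this
  have hj : ∀ j, blockNorm Φ f s' p j ≤ ((2 : ℝ≥0∞) ^ (s' - s)) ^ j * C := fun j => by
    rw [← add_sub_cancel s s', blockNorm_add, add_sub_cancel_left]
    gcongr
    exact hb j
  by_cases hqt : q = ⊤
  · subst hqt
    refine memBesov_top_iff.2 ⟨C, hC, fun j => (hj j).trans ?_⟩
    exact mul_le_of_le_one_left' (pow_le_one' hr.le j)
  have hq' : 0 < q.toReal := ENNReal.toReal_pos hq.ne' hqt
  rw [MemBesov, besovNorm, if_neg hqt]
  refine ENNReal.rpow_lt_top_of_nonneg (by positivity) (ne_top_of_le_ne_top ?_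
    (ENNReal.tsum_le_tsum fun j => ENNReal.rpow_le_rpow (hj j) hq'.le))
  have hr' : ((2 : ℝ≥0∞) ^ (s' - s)) ^ q.toReal < 1 := ENNReal.rpow_lt_one hr hq'
  have : ∀ j : ℕ, (((2 : ℝ≥0∞) ^ (s' - s)) ^ j * C) ^ q.toReal
      = (((2 : ℝ≥0∞) ^ (s' - s)) ^ q.toReal) ^ j * C ^ q.toReal := fun j => by
    rw [ENNReal.mul_rpow_of_nonneg _ _ hq'.le, ← ENNReal.rpow_natCast, ← ENNReal.rpow_natCast,
      ← ENNReal.rpow_mul, mul_comm (j : ℝ), ENNReal.rpow_mul]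
  simp only [this]
  rw [ENNReal.tsum_mul_right, ENNReal.tsum_geometric]
  exact ENNReal.mul_ne_top (ENNReal.inv_ne_top.2 (tsub_pos_of_lt hr').ne')
    (ENNReal.rpow_ne_top_of_nonneg hq'.le hC)

theorem criticalSmoothnessPQ_eq_top {p q : ℝ≥0∞} (hq : 0 < q) :
    criticalSmoothnessPQ Φ f p q = criticalSmoothnessPQ Φ f p ⊤ := by
  refine le_antisymm (iSup₂_le fun s hs => le_iSup₂_of_le s (hs.to_top hq) le_rfl) ?_
  refine iSup₂_le fun s hs => EReal.le_of_forall_lt_iff_le.1 fun r hr => ?_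
  by_contra hrs
  have hlt : r < s := EReal.coe_lt_coe_iff.1 (not_le.1 hrs)
  exact hr.not_ge (le_iSup₂_of_le r (hs.of_top hq hlt) le_rfl)

theorem le_criticalSmoothness {s : ℝ} {p : ℝ≥0∞} (hp : 0 < p) (h : MemBesov Φ f s p ⊤) :
    (s : EReal) ≤ criticalSmoothness Φ f p := by
  rw [criticalSmoothness, criticalSmoothnessPQ_eq_top hp]
  exact le_iSup₂_of_le s h le_rfl

theorem memBesov_of_lt_criticalSmoothness {s : ℝ} {p : ℝ≥0∞} (hp : 0 < p)
    (h : (s : EReal) < criticalSmoothness Φ f p) : MemBesov Φ f s p ⊤ := by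
  rw [criticalSmoothness] at h
  obtain ⟨r, hr⟩ := lt_iSup_iff.1 h
  obtain ⟨hr, hlt⟩ := lt_iSup_iff.1 hr
  exact (hr.to_top hp).of_top ENNReal.zero_lt_top (EReal.coe_lt_coe_iff.1 hlt)

theorem MemBesov.mono_exponent {s : ℝ} {p p' : ℝ≥0∞} (hp : p ≤ p') (h : MemBesov Φ f s p' ⊤) :
    MemBesov Φ f s p ⊤ := by
  obtain ⟨C, hC, hb⟩ := memBesov_top_iff.1 h
  refine memBesov_top_iff.2 ⟨C, hC, fun j => le_trans ?_ (hb j)⟩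
  unfold blockNorm
  gcongr
  exact eLpNorm_le_eLpNorm_of_exponent_le hp (aestronglyMeasurable_block Φ f j)

/-- Lyapunov's inequality: `log ‖h‖_{1/t}` is a convex function of `t`. -/
theorem eLpNorm_le_rpow_mul_rpow {α : Type*} {m : MeasurableSpace α} {μ : Measure α} {h : α → ℂ}
    (hh : AEStronglyMeasurable h μ) {a b t u : ℝ} (ha : 0 < a) (hb : 0 < b) (ht : 0 ≤ t)
    (hu : 0 ≤ u) (hab : a + b = 1) :
    eLpNorm h (ENNReal.ofReal (a * t + b * u))⁻¹ μ ≤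
      eLpNorm h (ENNReal.ofReal t)⁻¹ μ ^ a * eLpNorm h (ENNReal.ofReal u)⁻¹ μ ^ b := by
  -- This is Hölder's inequality for `‖h‖ = ‖h‖ ^ a * ‖h‖ ^ b`. In `ℝ≥0∞` the inverse of `0` is `⊤`,
  -- so `t = 0` or `u = 0` covers `p = ∞` without a separate case.
  have : ENNReal.HolderTriple (ENNReal.ofReal (a * t))⁻¹ (ENNReal.ofReal (b * u))⁻¹
      (ENNReal.ofReal (a * t + b * u))⁻¹ :=
    ⟨by rw [inv_inv, inv_inv, inv_inv, ENNReal.ofReal_add (by positivity) (by positivity)]⟩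
  have key : ∀ {c v : ℝ}, 0 < c → 0 ≤ v →
      eLpNorm (fun x => ‖h x‖ ^ c) (ENNReal.ofReal (c * v))⁻¹ μ
        = eLpNorm h (ENNReal.ofReal v)⁻¹ μ ^ c := fun {c v} hc hv => by
    rw [eLpNorm_norm_rpow h hc, ENNReal.ofReal_mul hc.le,
      ENNReal.mul_inv (by simp [hc]) (by simp), mul_right_comm,
      ENNReal.inv_mul_cancel (by simpa using hc) (by simp), one_mul]
  have hm : ∀ {c : ℝ}, 0 < c → AEStronglyMeasurable (fun x => ‖h x‖ ^ c) μ := fun {c} hc =>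
    (Real.continuous_rpow_const hc.le).comp_aestronglyMeasurable hh.norm
  have h1 := eLpNorm_smul_le_mul_eLpNorm (p := (ENNReal.ofReal (a * t))⁻¹)
    (q := (ENNReal.ofReal (b * u))⁻¹) (r := (ENNReal.ofReal (a * t + b * u))⁻¹) (hm hb) (hm ha)
  rw [key ha ht, key hb hu] at h1
  refine le_trans (eLpNorm_mono fun x => ?_) h1
  rw [Pi.smul_apply', smul_eq_mul, ← Real.rpow_add_of_nonneg (norm_nonneg _) ha.le hb.le, hab,
    Real.rpow_one, norm_norm]

theorem MemBesov.interpolate {s r a b t u : ℝ} (ha : 0 < a) (hb : 0 < b) (hab : a + b = 1)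
    (ht : 0 ≤ t) (hu : 0 ≤ u) (h1 : MemBesov Φ f s (ENNReal.ofReal t)⁻¹ ⊤)
    (h2 : MemBesov Φ f r (ENNReal.ofReal u)⁻¹ ⊤) :
    MemBesov Φ f (a * s + b * r) (ENNReal.ofReal (a * t + b * u))⁻¹ ⊤ := by
  obtain ⟨C, hC, hbC⟩ := memBesov_top_iff.1 h1
  obtain ⟨D, hD, hbD⟩ := memBesov_top_iff.1 h2
  refine memBesov_top_iff.2 ⟨C ^ a * D ^ b, ENNReal.mul_ne_top
    (ENNReal.rpow_ne_top_of_nonneg ha.le hC) (ENNReal.rpow_ne_top_of_nonneg hb.le hD),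
    fun j => ?_⟩
  refine le_trans ?_ (mul_le_mul' (ENNReal.rpow_le_rpow (hbC j) ha.le)
    (ENNReal.rpow_le_rpow (hbD j) hb.le))
  unfold blockNorm
  rw [ENNReal.mul_rpow_of_nonneg _ _ ha.le, ENNReal.mul_rpow_of_nonneg _ _ hb.le,
    ← ENNReal.rpow_mul, ← ENNReal.rpow_mul, mul_mul_mul_comm,
    ← ENNReal.rpow_add _ _ (by simp) (by simp)]
  refine mul_le_mul' (le_of_eq (by congr 1; ring)) ?_
  exact eLpNorm_le_rpow_mul_rpow (aestronglyMeasurable_block Φ f j) ha hb ht hu hab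

-- Block `j` has at most `5 * 2 ^ j` terms, each at most `C * (5 * 4 ^ j) ^ N`, because `1 + k ^ 2 ≤
-- 5 * 4 ^ j` on its frequencies. This gives the exponent `-(1 + 2 * N)`, first for `p = ∞` and
-- hence for all `p`.
variable (Φ f) in
theorem exists_memBesov : ∃ s : ℝ, ∀ p : ℝ≥0∞, MemBesov Φ f s p ⊤ := by
  obtain ⟨C, N, h⟩ := polyBounded_fourierCoef f
  have hC : 0 ≤ C := by simpa using (norm_nonneg _).trans (h 0)
  refine ⟨-(1 + 2 * N : ℝ), fun p => MemBesov.mono_exponent (p' := ⊤) le_top ?_⟩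
  have hbound : ∀ j x, ‖block Φ f j x‖ ≤ (5 * C * 5 ^ N) * (2 ^ (1 + 2 * N)) ^ j := fun j x => by
    rw [block_eq_sum]
    have hX : (1 : ℝ) ≤ 2 ^ j := one_le_pow₀ one_le_two
    have hterm : ∀ k ∈ Finset.Icc (-2 ^ (j + 1) : ℤ) (2 ^ (j + 1)),
        ‖(dyadicFun Φ.φ₀ Φ.φ j k : ℂ) * fourierCoef f k * expFun k x‖
          ≤ C * (5 * (2 ^ j) ^ 2) ^ N := fun k hk => by
      rw [norm_mul, norm_mul, norm_expFun, mul_one, Complex.norm_real,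
        Real.norm_of_nonneg (dyadicFun_nonneg Φ j k)]
      have hk2 : |(k : ℝ)| ≤ 2 ^ (j + 1) := by
        have := abs_le.2 (Finset.mem_Icc.1 hk)
        exact_mod_cast this
      have hk3 : 1 + (k : ℝ) ^ 2 ≤ 5 * (2 ^ j) ^ 2 := by
        rw [pow_succ] at hk2
        rw [← sq_abs]
        nlinarith [abs_nonneg (k : ℝ)]
      calc dyadicFun Φ.φ₀ Φ.φ j k * ‖fourierCoef f k‖ ≤ 1 * ‖fourierCoef f k‖ := by
            gcongr; exact dyadicFun_le_one Φ j k
        _ ≤ C * (1 + (k : ℝ) ^ 2) ^ N := by rw [one_mul]; exact h k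
        _ ≤ _ := by gcongr
    refine (norm_sum_le_of_le _ hterm).trans ?_
    rw [Finset.sum_const, Int.card_Icc, nsmul_eq_mul]
    have hcard : (((2 ^ (j + 1) + 1 - -2 ^ (j + 1) : ℤ).toNat : ℕ) : ℝ) ≤ 5 * 2 ^ j := by
      have h0 : (0 : ℤ) ≤ 2 ^ (j + 1) + 1 - -2 ^ (j + 1) := by
        have : (0 : ℤ) < 2 ^ (j + 1) := by positivity
        linarith
      have h1 : (((2 ^ (j + 1) + 1 - -2 ^ (j + 1) : ℤ).toNat : ℕ) : ℝ)
          = ((2 ^ (j + 1) + 1 - -2 ^ (j + 1) : ℤ) : ℝ) := by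
        exact_mod_cast congrArg (Int.cast (R := ℝ)) (Int.toNat_of_nonneg h0)
      rw [h1]
      push_cast
      rw [pow_succ]
      linarith
    calc _ ≤ (5 * 2 ^ j) * (C * (5 * (2 ^ j) ^ 2) ^ N) := by gcongr
      _ = _ := by rw [mul_pow, ← pow_mul, ← pow_mul, ← pow_mul]; ring
  refine memBesov_top_iff.2 ⟨ENNReal.ofReal (5 * C * 5 ^ N), ENNReal.ofReal_ne_top, fun j => ?_⟩
  have h1 : eLpNorm (block Φ f j) ⊤ torusVol
      ≤ ENNReal.ofReal ((5 * C * 5 ^ N) * (2 ^ (1 + 2 * N)) ^ j) := by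
    rw [eLpNorm_exponent_top]
    exact eLpNormEssSup_le_of_ae_bound (Filter.Eventually.of_forall (hbound j))
  have h2 : (2 : ℝ≥0∞) ^ ((j : ℝ) * -(1 + 2 * N : ℝ))
      = ENNReal.ofReal ((((2 : ℝ) ^ (1 + 2 * N)) ^ j)⁻¹) := by
    rw [mul_neg, ENNReal.rpow_neg, ENNReal.ofReal_inv_of_pos (by positivity), ← pow_mul,
      ENNReal.ofReal_pow (by norm_num), ← ENNReal.rpow_natCast]
    push_cast
    rw [mul_comm (j : ℝ)]
    norm_num
  calc blockNorm Φ f (-(1 + 2 * N : ℝ)) ⊤ j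
      ≤ ENNReal.ofReal ((((2 : ℝ) ^ (1 + 2 * N)) ^ j)⁻¹)
        * ENNReal.ofReal ((5 * C * 5 ^ N) * (2 ^ (1 + 2 * N)) ^ j) := by
        rw [blockNorm, h2]; gcongr
    _ = ENNReal.ofReal (5 * C * 5 ^ N) := by
        rw [← ENNReal.ofReal_mul (by positivity)]
        congr 1
        field_simp

end Blocks

/-! ### Trigonometric polynomials and the Nikol'skii inequality -/

section Nikolskii

open MeasureTheory

theorem expFun_zero : expFun 0 = 1 := by
  ext x
  simp [expFun]

theorem expFun_mul (k l : ℤ) (x : ℝ) : expFun k x * expFun l x = expFun (k + l) x := by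
  rw [expFun, expFun, expFun, ← Complex.exp_add]
  congr 1
  push_cast
  ring

theorem integral_expFun (k : ℤ) : ∫ x in (0 : ℝ)..1, expFun k x = if k = 0 then 1 else 0 := by
  split_ifs with hk
  · subst hk
    simp [expFun_zero]
  · have hc : (2 * Real.pi * Complex.I * k : ℂ) ≠ 0 := by
      simp [hk, Real.pi_ne_zero]
    have h := intervalIntegral.integral_eq_sub_of_hasDerivAt (a := 0) (b := 1)
      (fun x _ => hasDerivAt_expFun k x)
      ((continuous_const.mul (contDiff_expFun k).continuous).intervalIntegrable _ _)
    have h2 : expFun k 1 = expFun k 0 := by simpa using periodic_expFun k 0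
    rw [intervalIntegral.integral_const_mul, h2, sub_self] at h
    exact (mul_eq_zero.1 h).resolve_left hc

theorem integral_expFun_mul (k l : ℤ) :
    ∫ x in (0 : ℝ)..1, expFun k x * expFun l x = if k + l = 0 then 1 else 0 := by
  simp only [expFun_mul, integral_expFun]

/-- Trigonometric polynomials of degree at most `N`. -/
def trigPoly (N : ℕ) : Submodule ℂ (ℝ → ℂ) :=
  Submodule.span ℂ (expFun '' {k : ℤ | |k| ≤ N})

theorem expFun_mem_trigPoly {N : ℕ} {k : ℤ} (hk : |k| ≤ N) : expFun k ∈ trigPoly N :=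
  Submodule.subset_span ⟨k, hk, rfl⟩

theorem mul_mem_trigPoly {N M : ℕ} {P Q : ℝ → ℂ} (hP : P ∈ trigPoly N) (hQ : Q ∈ trigPoly M) :
    P * Q ∈ trigPoly (N + M) := by
  have h := Submodule.mul_mem_mul hP hQ
  rw [trigPoly, trigPoly, Submodule.span_mul_span] at h
  refine Submodule.span_mono ?_ h
  rintro _ ⟨_, ⟨k, hk, rfl⟩, _, ⟨l, hl, rfl⟩, rfl⟩
  refine ⟨k + l, ?_, funext fun x => (expFun_mul k l x).symm⟩
  rw [Set.mem_ofPred_eq] at *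
  push_cast
  exact (abs_add_le k l).trans (add_le_add hk hl)

theorem pow_mem_trigPoly {N : ℕ} {P : ℝ → ℂ} (hP : P ∈ trigPoly N) (m : ℕ) :
    P ^ m ∈ trigPoly (m * N) := by
  induction m with
  | zero =>
    rw [pow_zero, ← expFun_zero]
    exact expFun_mem_trigPoly (by simp)
  | succ m ih =>
    rw [pow_succ, Nat.succ_mul]
    exact mul_mem_trigPoly ih hP

theorem continuous_of_mem_trigPoly {N : ℕ} {P : ℝ → ℂ} (hP : P ∈ trigPoly N) : Continuous P := by
  induction hP using Submodule.span_induction with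
  | mem P h =>
    obtain ⟨k, -, rfl⟩ := h
    exact (contDiff_expFun k).continuous
  | zero => exact continuous_const
  | add P Q _ _ hP hQ => exact hP.add hQ
  | smul c P _ hP => exact hP.const_smul c

/-- This reproducing formula has `2 * N + 1` terms, and each coefficient is bounded by the `L_1`
norm; that is Nikol'skii's inequality for `p = 1`. -/
theorem eq_sum_of_mem_trigPoly {N : ℕ} {P : ℝ → ℂ} (hP : P ∈ trigPoly N) (x : ℝ) :
    P x = ∑ l ∈ Finset.Icc (-N : ℤ) N, expFun l x * ∫ y in (0 : ℝ)..1, expFun (-l) y * P y := by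
  have hint : ∀ {Q : ℝ → ℂ}, Q ∈ trigPoly N → ∀ l : ℤ,
      IntervalIntegrable (fun y => expFun l y * Q y) volume 0 1 := fun hQ l =>
    ((contDiff_expFun l).continuous.mul (continuous_of_mem_trigPoly hQ)).intervalIntegrable _ _
  induction hP using Submodule.span_induction with
  | mem P h =>
    obtain ⟨k, hk, rfl⟩ := h
    rw [Finset.sum_eq_single_of_mem k (Finset.mem_Icc.2 (abs_le.1 hk))]
    · rw [integral_expFun_mul, if_pos (by ring), mul_one]
    · intro l _ hl
      rw [integral_expFun_mul, if_neg (fun h => hl (by omega)), mul_zero]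
  | zero => simp
  | add P Q hP' hQ' hP hQ =>
    rw [Pi.add_apply, hP, hQ, ← Finset.sum_add_distrib]
    refine Finset.sum_congr rfl fun l _ => ?_
    simp only [Pi.add_apply, mul_add]
    rw [intervalIntegral.integral_add (hint hP' _) (hint hQ' _), mul_add]
  | smul c P _ hP =>
    rw [Pi.smul_apply, hP, Finset.smul_sum]
    refine Finset.sum_congr rfl fun l _ => ?_
    simp only [Pi.smul_apply, smul_eq_mul]
    rw [← mul_assoc c, mul_comm c, mul_assoc, ← intervalIntegral.integral_const_mul]
    congr 2
    ext y
    ring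

theorem enorm_le_lintegral_of_mem_trigPoly {N : ℕ} {P : ℝ → ℂ} (hP : P ∈ trigPoly N) (x : ℝ) :
    ‖P x‖ₑ ≤ (2 * N + 1 : ℕ) * ∫⁻ y, ‖P y‖ₑ ∂torusVol := by
  have hterm : ∀ l : ℤ, ‖expFun l x * ∫ y in (0 : ℝ)..1, expFun (-l) y * P y‖ₑ
      ≤ ∫⁻ y, ‖P y‖ₑ ∂torusVol := fun l => by
    have he : ∀ (k : ℤ) (y : ℝ), ‖expFun k y‖ₑ = 1 := fun k y => by
      rw [← ofReal_norm, norm_expFun, ENNReal.ofReal_one]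
    rw [enorm_mul, he, one_mul, intervalIntegral.integral_of_le zero_le_one]
    refine (enorm_integral_le_lintegral_enorm _).trans (le_of_eq ?_)
    simp only [enorm_mul, he, one_mul]
  rw [eq_sum_of_mem_trigPoly hP x]
  refine (enorm_sum_le _ _).trans ((Finset.sum_le_sum fun l _ => hterm l).trans (le_of_eq ?_))
  rw [Finset.sum_const, Int.card_Icc, nsmul_eq_mul]
  congr 3
  omega

/-- With `M` the supremum of `‖P‖`, one has `‖P‖ ≤ M ^ (1 - r) * ‖P‖ ^ r`. Inserting this in the
`L_1` bound and cancelling `M ^ (1 - r)` requires `M` to be finite and nonzero. -/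
theorem iSup_enorm_rpow_le {N : ℕ} {P : ℝ → ℂ} (hP : P ∈ trigPoly N) {r : ℝ} (hr : 0 < r)
    (hr1 : r ≤ 1) :
    (⨆ x, ‖P x‖ₑ) ^ r ≤ (2 * N + 1 : ℕ) * ∫⁻ y, ‖P y‖ₑ ^ r ∂torusVol := by
  set M := ⨆ x, ‖P x‖ₑ with hM
  have hMtop : M ≠ ⊤ := by
    refine ne_top_of_le_ne_top ?_ (iSup_le fun x => enorm_le_lintegral_of_mem_trigPoly hP x)
    refine ENNReal.mul_ne_top (ENNReal.natCast_ne_top _) ?_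
    exact ((continuous_of_mem_trigPoly hP).integrableOn_Ioc).hasFiniteIntegral.ne
  rcases eq_or_ne M 0 with h0 | h0
  · rw [h0, ENNReal.zero_rpow_of_pos hr]
    exact zero_le
  have h1 : ∫⁻ y, ‖P y‖ₑ ∂torusVol ≤ M ^ (1 - r) * ∫⁻ y, ‖P y‖ₑ ^ r ∂torusVol := by
    rw [← lintegral_const_mul' _ _ (ENNReal.rpow_ne_top_of_nonneg (by linarith) hMtop)]
    refine lintegral_mono fun y => ?_
    calc ‖P y‖ₑ = ‖P y‖ₑ ^ (1 - r) * ‖P y‖ₑ ^ r := by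
          rw [← ENNReal.rpow_add_of_nonneg _ _ (by linarith) hr.le]; simp
      _ ≤ _ := by
          refine mul_le_mul_left (ENNReal.rpow_le_rpow ?_ (by linarith)) _
          exact le_iSup (fun x => ‖P x‖ₑ) y
  have h2 : M ^ (1 - r) * M ^ r
      ≤ M ^ (1 - r) * ((2 * N + 1 : ℕ) * ∫⁻ y, ‖P y‖ₑ ^ r ∂torusVol) := by
    rw [← ENNReal.rpow_add_of_nonneg _ _ (by linarith) hr.le, sub_add_cancel, ENNReal.rpow_one]
    refine iSup_le fun x => (enorm_le_lintegral_of_mem_trigPoly hP x).trans ?_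
    rw [mul_left_comm]
    gcongr
  exact (ENNReal.mul_le_mul_iff_right (ENNReal.rpow_pos (pos_iff_ne_zero.2 h0) hMtop).ne'
    (ENNReal.rpow_ne_top_of_nonneg (by linarith) hMtop)).1 h2

/-- The Nikol'skii inequality between `L_∞` and `L_p`. -/
theorem enorm_rpow_le_of_mem_trigPoly {N m : ℕ} {P : ℝ → ℂ} (hP : P ∈ trigPoly N) {p : ℝ}
    (hp : 0 < p) (hpm : p ≤ m) (x : ℝ) :
    ‖P x‖ₑ ^ p ≤ (2 * (m * N) + 1 : ℕ) * ∫⁻ y, ‖P y‖ₑ ^ p ∂torusVol := by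
  have hm : (0 : ℝ) < m := hp.trans_le hpm
  -- Large exponents reduce to the case `r ≤ 1` by passing to `P ^ m`: its degree is at most `m *
  -- N`, which affects only the constant.
  have h := iSup_enorm_rpow_le (pow_mem_trigPoly hP m) (div_pos hp hm) ((div_le_one hm).2 hpm)
  have key : ∀ y, ‖(P ^ m) y‖ₑ ^ (p / m) = ‖P y‖ₑ ^ p := fun y => by
    rw [Pi.pow_apply, enorm_pow, ← ENNReal.rpow_natCast, ← ENNReal.rpow_mul,
      mul_div_cancel₀ _ hm.ne']
  simp only [key] at h
  rw [← key x]
  exact (ENNReal.rpow_le_rpow (le_iSup (fun y => ‖(P ^ m) y‖ₑ) x) (by positivity)).trans h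

variable {Φ : DyadicSystem} {f : GeneralizedFunction}

variable (Φ f) in
theorem block_mem_trigPoly (j : ℕ) : block Φ f j ∈ trigPoly (2 ^ (j + 1)) := by
  have : block Φ f j = ∑ k ∈ Finset.Icc (-2 ^ (j + 1) : ℤ) (2 ^ (j + 1)),
      ((dyadicFun Φ.φ₀ Φ.φ j k : ℂ) * fourierCoef f k) • expFun k := by
    ext x
    rw [block_eq_sum, Finset.sum_apply]
    rfl
  rw [this]
  refine Submodule.sum_mem _ fun k hk => Submodule.smul_mem _ _ (expFun_mem_trigPoly ?_)
  push_cast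
  exact abs_le.2 (Finset.mem_Icc.1 hk)

/-- Nikol'skii's constant for degree `2 ^ (j + 1)` is at most `(K * 2 ^ j) ^ t`; the factor `2 ^ (j
* t)` is exactly what lowering `s` by `t` absorbs. -/
theorem MemBesov.sub_top {s t : ℝ} (ht : 0 ≤ t) (h : MemBesov Φ f s (ENNReal.ofReal t)⁻¹ ⊤) :
    MemBesov Φ f (s - t) ⊤ ⊤ := by
  rcases ht.eq_or_lt with rfl | ht
  · simpa using h
  obtain ⟨C, hC, hb⟩ := memBesov_top_iff.1 h
  have hp : (0 : ℝ) < t⁻¹ := inv_pos.2 ht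
  set p : ℝ≥0∞ := (ENNReal.ofReal t)⁻¹ with hpdef
  have hpr : p.toReal = t⁻¹ := by rw [hpdef, ENNReal.toReal_inv, ENNReal.toReal_ofReal ht.le]
  have hp0 : p ≠ 0 := by simp [hpdef]
  have hpt : p ≠ ⊤ := by simpa [hpdef] using ht
  set m : ℕ := ⌈t⁻¹⌉₊
  have hm : t⁻¹ ≤ m := Nat.le_ceil _
  set K : ℝ≥0∞ := ((4 * m + 1 : ℕ) : ℝ≥0∞)
  refine memBesov_top_iff.2 ⟨K ^ t * C, ENNReal.mul_ne_top (ENNReal.rpow_ne_top_of_nonneg ht.le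
    (ENNReal.natCast_ne_top _)) hC, fun j => ?_⟩
  have hN : eLpNorm (block Φ f j) ⊤ torusVol
      ≤ (K * 2 ^ j) ^ t * eLpNorm (block Φ f j) p torusVol := by
    rw [eLpNorm_exponent_top]
    refine eLpNormEssSup_le_of_ae_enorm_bound (Filter.Eventually.of_forall fun x => ?_)
    have h1 := enorm_rpow_le_of_mem_trigPoly (block_mem_trigPoly Φ f j) hp hm x
    rw [eLpNorm_eq_lintegral_rpow_enorm_toReal hp0 hpt, hpr, one_div, inv_inv,
      ← ENNReal.mul_rpow_of_nonneg _ _ ht.le]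
    have h2 := ENNReal.rpow_le_rpow h1 ht.le
    rw [← ENNReal.rpow_mul, inv_mul_cancel₀ ht.ne', ENNReal.rpow_one] at h2
    refine h2.trans (ENNReal.rpow_le_rpow ?_ ht.le)
    gcongr
    have : 2 * (m * 2 ^ (j + 1)) + 1 ≤ (4 * m + 1) * 2 ^ j := by
      have := Nat.one_le_two_pow (n := j)
      rw [pow_succ]
      nlinarith
    calc ((2 * (m * 2 ^ (j + 1)) + 1 : ℕ) : ℝ≥0∞) ≤ (((4 * m + 1) * 2 ^ j : ℕ) : ℝ≥0∞) := by
          exact_mod_cast this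
      _ = _ := by simp only [K]; push_cast; rfl
  have h3 : (2 : ℝ≥0∞) ^ ((j : ℝ) * (s - t)) * (2 ^ j) ^ t = 2 ^ ((j : ℝ) * s) := by
    rw [← ENNReal.rpow_natCast, ← ENNReal.rpow_mul, ← ENNReal.rpow_add _ _ (by simp) (by simp)]
    congr 1
    ring
  calc blockNorm Φ f (s - t) ⊤ j
      ≤ 2 ^ ((j : ℝ) * (s - t)) * ((K * 2 ^ j) ^ t * eLpNorm (block Φ f j) p torusVol) := by
        rw [blockNorm]; gcongr
    _ = K ^ t * blockNorm Φ f s p j := by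
        rw [blockNorm, ENNReal.mul_rpow_of_nonneg _ _ ht.le, ← h3]
        ring
    _ ≤ K ^ t * C := by gcongr; exact hb j

end Nikolskii

/-! ### Fourier expansion of smooth periodic functions -/

section FourierExpansion

open MeasureTheory Filter Topology

namespace SmoothTorus

theorem continuous_lift (u : SmoothTorus) : Continuous (u.periodic.lift : AddCircle (1 : ℝ) → ℂ) :=
  u.contDiff.continuous.quotient_liftOn' _

/-- A smooth periodic function as a continuous function on the circle. -/
def toCircle (u : SmoothTorus) : C(AddCircle (1 : ℝ), ℂ) := ⟨u.periodic.lift, u.continuous_lift⟩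

theorem toCircle_coe (u : SmoothTorus) (x : ℝ) : u.toCircle (x : AddCircle (1 : ℝ)) = u x := rfl

theorem fourier_coe (k : ℤ) (x : ℝ) : fourier k (x : AddCircle (1 : ℝ)) = expFun k x := by
  rw [fourier_coe_apply, expFun]
  simp

theorem fourierCoeff_toCircle (u : SmoothTorus) (k : ℤ) :
    fourierCoeff u.toCircle k = expPairing (-k) u := by
  rw [fourierCoeff_eq_intervalIntegral _ _ 0, expPairing]
  simp only [fourier_coe, toCircle_coe, smul_eq_mul, zero_add, div_one, one_smul]

theorem summable_norm_expPairing (u : SmoothTorus) : Summable fun k => ‖expPairing k u‖ := by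
  refine Summable.of_nonneg_of_le (fun _ => norm_nonneg _) (fun k => ?_)
    (summable_one_add_sq_inv.mul_left (supSeminorm 0 u + supSeminorm (2 * 1) u))
  have := norm_expPairing_le k 1 u
  rw [← div_eq_mul_inv, le_div_iff₀ (by positivity)]
  linarith

theorem summable_norm_expPairing_neg (u : SmoothTorus) :
    Summable fun k => ‖expPairing (-k) u‖ :=
  (Equiv.neg ℤ).summable_iff.2 u.summable_norm_expPairing

theorem hasSum_expPairing_mul_expFun (u : SmoothTorus) (x : ℝ) :
    HasSum (fun k => expPairing (-k) u * expFun k x) (u x) := by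
  have hs : Summable (fourierCoeff u.toCircle) := by
    rw [funext u.fourierCoeff_toCircle]
    exact u.summable_norm_expPairing_neg.of_norm
  have h := has_pointwise_sum_fourier_series_of_summable hs (x : AddCircle (1 : ℝ))
  simpa only [fourier_coe, toCircle_coe, fourierCoeff_toCircle, smul_eq_mul] using h

theorem coe_sub (u v : SmoothTorus) : ((u - v : SmoothTorus) : ℝ → ℂ) = (u : ℝ → ℂ) - v := rfl

/-- Differentiation as a linear map. -/
def derivLinear : SmoothTorus →ₗ[ℂ] SmoothTorus where
  toFun := deriv
  map_add' u v := Subtype.ext <| funext fun x =>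
    deriv_add (u.contDiff.differentiable (by simp) x) (v.contDiff.differentiable (by simp) x)
  map_smul' c u := Subtype.ext <| funext fun x =>
    deriv_const_smul c (u.contDiff.differentiable (by simp) x)

/-- Partial sums of the Fourier series. -/
def partialSum (s : Finset ℤ) (u : SmoothTorus) : SmoothTorus :=
  ∑ k ∈ s, expPairing (-k) u • expTorus k

theorem partialSum_apply (s : Finset ℤ) (u : SmoothTorus) (x : ℝ) :
    partialSum s u x = ∑ k ∈ s, expPairing (-k) u * expFun k x := by
  unfold partialSum
  induction s using Finset.cons_induction with
  | empty => rfl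
  | cons a s ha ih =>
    rw [Finset.sum_cons, Finset.sum_cons, ← ih]
    rfl

theorem deriv_expTorus (k : ℤ) :
    derivLinear (expTorus k) = (2 * Real.pi * Complex.I * k) • expTorus k :=
  Subtype.ext <| funext fun x => (hasDerivAt_expFun k x).deriv

theorem derivLinear_partialSum (s : Finset ℤ) (u : SmoothTorus) :
    derivLinear (partialSum s u) = partialSum s u.deriv := by
  rw [partialSum, map_sum, partialSum]
  refine Finset.sum_congr rfl fun k _ => ?_
  rw [map_smul, deriv_expTorus, expPairing_deriv, smul_smul]
  congr 1
  push_cast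
  ring

/-- Differentiation commutes with Fourier partial sums, so each seminorm of the remainder is the sup
norm of a remainder for a derivative of `u`. -/
theorem iterate_deriv_partialSum_sub (n : ℕ) (s : Finset ℤ) (u : SmoothTorus) :
    deriv^[n] (partialSum s u - u) = partialSum s (deriv^[n] u) - deriv^[n] u := by
  induction n with
  | zero => rfl
  | succ n ih =>
    rw [Function.iterate_succ_apply', ih, Function.iterate_succ_apply']
    change derivLinear _ = _
    rw [map_sub, derivLinear_partialSum]
    rfl

theorem norm_partialSum_sub_le (s : Finset ℤ) (u : SmoothTorus) (x : ℝ) :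
    ‖(partialSum s u - u : SmoothTorus) x‖ ≤
      ∑' k : {k // k ∉ s}, ‖expPairing (-(k : ℤ)) u‖ := by
  have hs := (u.hasSum_expPairing_mul_expFun x)
  have h1 : (partialSum s u - u : SmoothTorus) x
      = -∑' k : {k // k ∉ s}, expPairing (-(k : ℤ)) u * expFun k x := by
    have := hs.summable.sum_add_tsum_subtype_compl s
    rw [hs.tsum_eq] at this
    rw [coe_sub, Pi.sub_apply, partialSum_apply, ← this]
    ring
  rw [h1, norm_neg]
  have h2 : ∀ k, ‖expPairing (-k) u * expFun k x‖ = ‖expPairing (-k) u‖ := fun k => by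
    rw [norm_mul, norm_expFun, mul_one]
  refine (norm_tsum_le_tsum_norm ?_).trans (le_of_eq ?_)
  · simp only [h2]
    exact u.summable_norm_expPairing_neg.subtype _
  · simp only [h2]

/-- The Fourier series of a smooth periodic function converges in the Fréchet topology. -/
theorem hasSum_expPairing_smul_expTorus (u : SmoothTorus) :
    HasSum (fun k => expPairing (-k) u • expTorus k) u := by
  refine (withSeminorms.tendsto_nhds _ _).2 fun n ε hε => ?_
  have h := tendsto_tsum_compl_atTop_zero fun k => ‖expPairing (-k) (deriv^[n] u)‖
  filter_upwards [h.eventually_lt_const hε] with s hs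
  refine lt_of_le_of_lt (ciSup_le fun x => ?_) hs
  have := norm_partialSum_sub_le s (deriv^[n] u) x
  rwa [← iterate_deriv_partialSum_sub, iterate_deriv_coe] at this

end SmoothTorus

variable {f : GeneralizedFunction}

/-- A generalized function is thus determined by its Fourier coefficients. -/
theorem hasSum_fourierCoef_mul_expPairing (f : GeneralizedFunction) (u : SmoothTorus) :
    HasSum (fun k => fourierCoef f k * expPairing k u) (f u) := by
  have h := u.hasSum_expPairing_smul_expTorus.mapL f
  rw [← (Equiv.neg ℤ).hasSum_iff] at h
  refine h.congr_fun fun k => ?_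
  simp [fourierCoef, mul_comm]

theorem fourierCoef_fourierSeries (a : ℤ → ℂ) (h : PolyBounded a) (k : ℤ) :
    fourierCoef (fourierSeries a h) k = a k := by
  have hp : ∀ n, expPairing n (expTorus (-k)) = if n = k then 1 else 0 := fun n => by
    have := integral_expFun_mul n (-k)
    simp only [← sub_eq_add_neg, sub_eq_zero] at this
    exact this
  change ∑' n : ℤ, a n * expPairing n (expTorus (-k)) = a k
  simp [hp]

/-! ### Rapidly decreasing Fourier coefficients -/

theorem isSmooth_of_rapid_decay
    (h : ∀ N : ℕ, ∃ C : ℝ, ∀ k : ℤ, (1 + (k : ℝ) ^ 2) ^ N * ‖fourierCoef f k‖ ≤ C) :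
    IsSmooth f := by
  choose C hC using h
  -- Decay of order `n + 1` pays for `n` derivatives and leaves the summable factor `(1 + k ^ 2)⁻¹`.
  have hterm : ∀ (n : ℕ) (k : ℤ) (x : ℝ),
      ‖iteratedFDeriv ℝ n (fun x => fourierCoef f k * expFun k x) x‖
        ≤ (2 * Real.pi) ^ n * C (n + 1) * (1 + (k : ℝ) ^ 2)⁻¹ := fun n k x => by
    have h1 : iteratedDeriv n (fun x => fourierCoef f k * expFun k x) x
        = fourierCoef f k * ((2 * Real.pi * Complex.I * k) ^ n * expFun k x) := by
      rw [iteratedDeriv_const_mul_field, iteratedDeriv_expFun]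
    have h2 : ‖(2 * Real.pi * Complex.I * k : ℂ)‖ = 2 * Real.pi * |(k : ℝ)| := by
      simp [abs_of_pos Real.pi_pos]
    have h5 : |(k : ℝ)| ≤ 1 + (k : ℝ) ^ 2 := by
      rw [← sq_abs]; nlinarith [sq_nonneg (|(k : ℝ)| - 1), abs_nonneg (k : ℝ)]
    rw [norm_iteratedFDeriv_eq_norm_iteratedDeriv, h1, norm_mul, norm_mul, norm_pow, norm_expFun,
      mul_one, h2, ← div_eq_mul_inv, le_div_iff₀ (by positivity), mul_pow]
    calc ‖fourierCoef f k‖ * ((2 * Real.pi) ^ n * |(k : ℝ)| ^ n) * (1 + (k : ℝ) ^ 2)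
        ≤ ‖fourierCoef f k‖ * ((2 * Real.pi) ^ n * (1 + (k : ℝ) ^ 2) ^ n) * (1 + (k : ℝ) ^ 2) := by
          gcongr
      _ = (2 * Real.pi) ^ n * ((1 + (k : ℝ) ^ 2) ^ (n + 1) * ‖fourierCoef f k‖) := by ring
      _ ≤ _ := by gcongr; exact hC _ k
  have hsmooth : ContDiff ℝ ∞ fun x => ∑' k, fourierCoef f k * expFun k x :=
    contDiff_tsum (fun k => contDiff_const.mul (contDiff_expFun k))
      (fun n _ => summable_one_add_sq_inv.mul_left _) fun n k x _ => hterm n k x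
  refine ⟨⟨fun x => ∑' k, fourierCoef f k * expFun k x, hsmooth, fun x => ?_⟩, fun u => ?_⟩
  · simp only [periodic_expFun _ x]
  have hb : ∀ k, ‖fourierCoef f k‖ ≤ C 1 * (1 + (k : ℝ) ^ 2)⁻¹ := fun k => by
    rw [← div_eq_mul_inv, le_div_iff₀ (by positivity)]
    have := hC 1 k
    linarith
  have hint := intervalIntegral.hasSum_integral_of_dominated_convergence (a := 0) (b := 1)
    (μ := volume) (F := fun k x => fourierCoef f k * expFun k x * u x)
    (f := fun x => (∑' k, fourierCoef f k * expFun k x) * u x)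
    (fun k _ => C 1 * (1 + (k : ℝ) ^ 2)⁻¹ * SmoothTorus.supSeminorm 0 u)
    (fun k => (((contDiff_const.mul (contDiff_expFun k)).continuous).mul
      u.contDiff.continuous).aestronglyMeasurable)
    (fun k => Eventually.of_forall fun x _ => by
      rw [norm_mul, norm_mul, norm_expFun, mul_one]
      have h0 := SmoothTorus.norm_iteratedDeriv_le 0 u x
      rw [iteratedDeriv_zero] at h0
      have := (norm_nonneg _).trans (hb k)
      gcongr
      exact hb k)
    (Eventually.of_forall fun x _ => (summable_one_add_sq_inv.mul_left _).mul_right _)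
    (by simp)
    (Eventually.of_forall fun x _ => by
      refine HasSum.mul_right _ (Summable.hasSum ?_)
      refine (summable_one_add_sq_inv.mul_left (C 1)).of_norm_bounded fun k => ?_
      rw [norm_mul, norm_expFun, mul_one]
      exact hb k)
  refine (hasSum_fourierCoef_mul_expPairing f u).unique ?_
  refine hint.congr_fun fun k => ?_
  simp only [expPairing, mul_assoc, intervalIntegral.integral_const_mul]

variable {Φ : DyadicSystem}

theorem integral_expFun_mul_block (j : ℕ) (k : ℤ) :
    ∫ x in (0 : ℝ)..1, expFun (-k) x * block Φ f j x
      = (dyadicFun Φ.φ₀ Φ.φ j k : ℂ) * fourierCoef f k := by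
  simp only [block_eq_sum, Finset.mul_sum]
  rw [intervalIntegral.integral_finsetSum]
  swap
  · exact fun l _ => ((contDiff_expFun _).continuous.mul
      (continuous_const.mul (contDiff_expFun l).continuous)).intervalIntegrable _ _
  have h : ∀ l : ℤ, ∫ x in (0 : ℝ)..1, expFun (-k) x *
      ((dyadicFun Φ.φ₀ Φ.φ j l : ℂ) * fourierCoef f l * expFun l x)
      = if l = k then (dyadicFun Φ.φ₀ Φ.φ j k : ℂ) * fourierCoef f k else 0 := fun l => by
    simp only [mul_left_comm (expFun (-k) _)]
    rw [intervalIntegral.integral_const_mul, integral_expFun_mul]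
    rcases eq_or_ne l k with rfl | hl
    · simp
    · rw [if_neg (fun h => hl (by omega)), if_neg hl, mul_zero]
  simp only [h, Finset.sum_ite_eq']
  split_ifs with hk
  · rfl
  · rw [dyadicFun_eq_zero Φ hk]
    simp

theorem isSmooth_of_forall_memBesov (h : ∀ s, MemBesov Φ f s ⊤ ⊤) : IsSmooth f := by
  refine isSmooth_of_rapid_decay fun N => ?_
  -- The `L_1` norm of a block dominates its Fourier coefficients. Of the smoothness `2 * N + 1`,
  -- the part `2 * N` compensates `(1 + k ^ 2) ^ N` and the extra `1` leaves the factor `(1 / 2) ^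
  -- j`.
  obtain ⟨C, hC, hb⟩ := memBesov_top_iff.1 ((h (2 * N + 1)).mono_exponent (p := 1) le_top)
  have hblock : ∀ (j : ℕ) (k : ℤ),
      dyadicFun Φ.φ₀ Φ.φ j k * ‖fourierCoef f k‖ * (2 ^ (2 * N + 1)) ^ j ≤ C.toReal := fun j k => by
    have h1 : ‖(dyadicFun Φ.φ₀ Φ.φ j k : ℂ) * fourierCoef f k‖ₑ ≤ eLpNorm (block Φ f j) 1 torusVol := by
      rw [← integral_expFun_mul_block, intervalIntegral.integral_of_le zero_le_one,
        eLpNorm_one_eq_lintegral_enorm]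
      refine (enorm_integral_le_lintegral_enorm _).trans (le_of_eq ?_)
      refine lintegral_congr fun x => ?_
      rw [enorm_mul, ← ofReal_norm (expFun (-k) x), norm_expFun, ENNReal.ofReal_one, one_mul]
    have h2 := hb j
    rw [blockNorm] at h2
    have h3 := (mul_le_mul_right h1 _).trans h2
    rw [← ENNReal.toReal_le_toReal (ne_top_of_le_ne_top hC h3) hC, ENNReal.toReal_mul,
      toReal_enorm, norm_mul, Complex.norm_real, Real.norm_of_nonneg (dyadicFun_nonneg Φ j k),
      ← ENNReal.toReal_rpow, mul_comm] at h3
    refine le_trans (le_of_eq ?_) h3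
    congr 1
    rw [← pow_mul, ← Real.rpow_natCast]
    push_cast
    rw [mul_comm (j : ℝ)]
    norm_num
  refine ⟨5 ^ N * C.toReal * 2, fun k => ?_⟩
  -- The bounds on single blocks are reassembled through `∑ φ_j(k) = 1`.
  have hs := (Φ.hasSum_one k).mul_left ((1 + (k : ℝ) ^ 2) ^ N * ‖fourierCoef f k‖)
  rw [mul_one] at hs
  refine hasSum_le (fun j => ?_) hs (hasSum_geometric_two.mul_left (5 ^ N * C.toReal))
  by_cases h0 : dyadicFun Φ.φ₀ Φ.φ j k = 0
  · rw [h0, mul_zero]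
    positivity
  have hk := abs_le_of_dyadicFun_ne_zero Φ h0
  have hX : (1 : ℝ) ≤ 2 ^ j := one_le_pow₀ one_le_two
  have hk3 : 1 + (k : ℝ) ^ 2 ≤ 5 * (2 ^ j) ^ 2 := by
    rw [pow_succ] at hk
    rw [← sq_abs]
    nlinarith [abs_nonneg (k : ℝ)]
  have hd := dyadicFun_nonneg Φ j k
  calc (1 + (k : ℝ) ^ 2) ^ N * ‖fourierCoef f k‖ * dyadicFun Φ.φ₀ Φ.φ j k
      ≤ (5 * (2 ^ j) ^ 2) ^ N * ‖fourierCoef f k‖ * dyadicFun Φ.φ₀ Φ.φ j k := by gcongr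
    _ = 5 ^ N * (dyadicFun Φ.φ₀ Φ.φ j k * ‖fourierCoef f k‖ * (2 ^ (2 * N + 1)) ^ j)
          * (1 / 2) ^ j := by
        rw [mul_pow, ← pow_mul, ← pow_mul, ← pow_mul, one_div, inv_pow]
        field_simp
        ring
    _ ≤ 5 ^ N * C.toReal * (1 / 2) ^ j := by gcongr; exact hblock j k

end FourierExpansion

/-! ### A family of periodic symbols -/

section Multiplier

open MeasureTheory Filter Topology

theorem cos_pi_div_eight_mem : 0 < Real.cos (Real.pi / 8) ∧ Real.cos (Real.pi / 8) < 1 := by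
  have hpi := Real.pi_pos
  refine ⟨Real.cos_pos_of_mem_Ioo ⟨by linarith, by linarith⟩, ?_⟩
  rw [← Real.cos_zero]
  exact Real.cos_lt_cos_of_nonneg_of_le_pi le_rfl (by linarith) (by linarith)

/-- A cut-off function that vanishes near `±1`. -/
def cosBump : ContDiffBump (0 : ℝ) where
  rIn := Real.cos (Real.pi / 8)
  rOut := (1 + Real.cos (Real.pi / 8)) / 2
  rIn_pos := cos_pi_div_eight_mem.1
  rIn_lt_rOut := by linarith [cos_pi_div_eight_mem.2]

theorem cosBump_eq_zero {c : ℝ} (hc : (1 + Real.cos (Real.pi / 8)) / 2 ≤ |c|) : cosBump c = 0 :=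
  cosBump.zero_of_le_dist (by simpa [cosBump] using hc)

/-- A positive smooth function with `squareFun (cos (2πx)) = (8x)²` for `1/16 ≤ |x| ≤ 1/4`. -/
def squareFun (c : ℝ) : ℝ :=
  cosBump c * (8 * Real.arccos c / (2 * Real.pi)) ^ 2 + (1 - cosBump c)

theorem contDiff_squareFun : ContDiff ℝ ∞ squareFun := by
  refine contDiff_iff_contDiffAt.2 fun c => ?_
  by_cases hc : |c| < 1
  · have h1 : c ≠ -1 := by rintro rfl; simp at hc
    have h2 : c ≠ 1 := by rintro rfl; simp at hc
    have ha : ContDiffAt ℝ ∞ Real.arccos c := Real.contDiffAt_arccos h1 h2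
    exact (cosBump.contDiffAt.mul (((contDiffAt_const.mul ha).div_const _).pow 2)).add
      (contDiffAt_const.sub cosBump.contDiffAt)
  · have hlt : (1 + Real.cos (Real.pi / 8)) / 2 < |c| := by
      linarith [cos_pi_div_eight_mem.2, not_lt.1 hc]
    have hev : squareFun =ᶠ[𝓝 c] fun _ => 1 := by
      filter_upwards [continuous_abs.continuousAt.eventually_const_lt hlt] with y hy
      rw [squareFun, cosBump_eq_zero (le_of_lt hy)]
      ring
    exact contDiffAt_const.congr_of_eventuallyEq hev

theorem squareFun_pos (c : ℝ) : 0 < squareFun c := by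
  by_cases h0 : cosBump c = 0
  · rw [squareFun, h0]
    norm_num
  have hc : |c| < 1 := by
    by_contra hc
    exact h0 (cosBump_eq_zero (by linarith [cos_pi_div_eight_mem.2, not_lt.1 hc]))
  have ha : 0 < Real.arccos c := Real.arccos_pos.2 (abs_lt.1 hc).2
  have hpi := Real.pi_pos
  have h1 : 0 < cosBump c := lt_of_le_of_ne cosBump.nonneg (Ne.symm h0)
  have h2 := cosBump.le_one (x := c)
  have h3 : 0 < cosBump c * (8 * Real.arccos c / (2 * Real.pi)) ^ 2 := by positivity
  rw [squareFun]
  linarith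

theorem squareFun_cos {x : ℝ} (h1 : 1 / 16 ≤ |x|) (h2 : |x| ≤ 1 / 4) :
    squareFun (Real.cos (2 * Real.pi * x)) = (8 * x) ^ 2 := by
  have hpi := Real.pi_pos
  have hcos : Real.cos (2 * Real.pi * x) = Real.cos (2 * Real.pi * |x|) := by
    rw [← Real.cos_abs, abs_mul, abs_of_pos (by positivity)]
  have ha : Real.arccos (Real.cos (2 * Real.pi * |x|)) = 2 * Real.pi * |x| :=
    Real.arccos_cos (by positivity) (by nlinarith)
  have hc0 : 0 ≤ Real.cos (2 * Real.pi * |x|) :=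
    Real.cos_nonneg_of_mem_Icc ⟨by nlinarith [abs_nonneg x], by nlinarith⟩
  have hc1 : Real.cos (2 * Real.pi * |x|) ≤ Real.cos (Real.pi / 8) :=
    Real.cos_le_cos_of_nonneg_of_le_pi (by positivity) (by nlinarith) (by nlinarith)
  have hb : cosBump (Real.cos (2 * Real.pi * |x|)) = 1 := by
    refine cosBump.one_of_mem_closedBall ?_
    rw [mem_closedBall_zero_iff, Real.norm_of_nonneg hc0]
    exact hc1
  rw [hcos, squareFun, hb, ha, one_mul, sub_self, add_zero, ← sq_abs (8 * x), abs_mul]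
  congr 1
  field_simp
  norm_num

/-- The joint symbol `(a² + squareFun (cos (2πx)))^{γ/2}`. -/
def symbolFun (γ : ℝ) (z : ℝ × ℝ) : ℂ :=
  (((z.1 ^ 2 + squareFun (Real.cos (2 * Real.pi * z.2))) ^ (γ / 2) : ℝ) : ℂ)

theorem contDiff_symbolFun (γ : ℝ) : ContDiff ℝ ∞ (symbolFun γ) := by
  refine Complex.ofRealCLM.contDiff.comp (ContDiff.rpow_const_of_ne ?_ fun z => ?_)
  · exact (contDiff_fst.pow 2).add (contDiff_squareFun.comp
      (Real.contDiff_cos.comp (contDiff_const.mul contDiff_snd)))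
  · exact (add_pos_of_nonneg_of_pos (sq_nonneg _) (squareFun_pos _)).ne'

/-- The symbol with the first variable frozen, as a smooth periodic function. -/
def symbol (γ a : ℝ) : SmoothTorus :=
  ⟨fun x => symbolFun γ (a, x), (contDiff_symbolFun γ).comp (contDiff_const.prodMk contDiff_id),
    fun x => by
      have : Real.cos (2 * Real.pi * (x + 1)) = Real.cos (2 * Real.pi * x) := by
        rw [mul_add, mul_one, Real.cos_add_two_pi]
      simp only [symbolFun, this]⟩

theorem exists_iteratedDeriv_eq {H : ℝ × ℝ → ℂ} (hH : ContDiff ℝ ∞ H) (n : ℕ) :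
    ∃ K : ℝ × ℝ → ℂ, ContDiff ℝ ∞ K ∧
      ∀ a x, iteratedDeriv n (fun x => H (a, x)) x = K (a, x) := by
  induction n with
  | zero => exact ⟨H, hH, fun a x => by rw [iteratedDeriv_zero]⟩
  | succ n ih =>
    obtain ⟨K, hK, h⟩ := ih
    refine ⟨fun z => fderiv ℝ K z (0, 1),
      (hK.fderiv_right (m := ∞) (by simp)).clm_apply contDiff_const, fun a x => ?_⟩
    rw [iteratedDeriv_succ, funext (h a)]
    have h1 : HasDerivAt (fun x : ℝ => (a, x)) ((0 : ℝ), (1 : ℝ)) x :=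
      (hasDerivAt_const x a).prodMk (hasDerivAt_id x)
    exact ((hK.differentiable (by simp) (a, x)).hasFDerivAt.comp_hasDerivAt x h1).deriv

theorem exists_supSeminorm_symbol_le (γ : ℝ) (n : ℕ) :
    ∃ C, ∀ a ∈ Set.Icc (0 : ℝ) 1, SmoothTorus.supSeminorm n (symbol γ a) ≤ C := by
  obtain ⟨K, hK, h⟩ := exists_iteratedDeriv_eq (contDiff_symbolFun γ) n
  obtain ⟨C, hC⟩ := (isCompact_Icc.prod isCompact_Icc :
    IsCompact (Set.Icc (0 : ℝ) 1 ×ˢ Set.Icc (0 : ℝ) 1)).exists_bound_of_continuousOn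
    hK.continuous.continuousOn
  refine ⟨C, fun a ha => ciSup_le fun x => ?_⟩
  rw [← SmoothTorus.iterate_deriv_coe]
  have hp := (SmoothTorus.deriv^[n] (symbol γ a)).periodic.sub_zsmul_eq ⌊x⌋ (x := x)
  simp only [zsmul_eq_mul, mul_one] at hp
  rw [← hp, SmoothTorus.iterate_deriv_coe]
  change ‖iteratedDeriv n (fun x => symbolFun γ (a, x)) _‖ ≤ C
  rw [h]
  exact hC _ ⟨ha, by linarith [Int.floor_le x], by linarith [Int.lt_floor_add_one x]⟩

theorem exists_expPairing_symbol_le (γ : ℝ) (N : ℕ) :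
    ∃ A : ℝ, 0 ≤ A ∧ ∀ a ∈ Set.Icc (0 : ℝ) 1, ∀ k : ℤ,
      ‖expPairing (-k) (symbol γ a)‖ ≤ A * ((1 + (k : ℝ) ^ 2)⁻¹) ^ N := by
  obtain ⟨C, hC⟩ := exists_supSeminorm_symbol_le γ 0
  obtain ⟨D, hD⟩ := exists_supSeminorm_symbol_le γ (2 * N)
  have h0 : (0 : ℝ) ∈ Set.Icc (0 : ℝ) 1 := by simp
  refine ⟨C + D, add_nonneg ((apply_nonneg _ _).trans (hC 0 h0)) ((apply_nonneg _ _).trans (hD 0 h0)),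
    fun a ha k => ?_⟩
  have h := norm_expPairing_le (-k) N (symbol γ a)
  rw [Int.cast_neg, neg_sq] at h
  rw [inv_pow, ← div_eq_mul_inv, le_div_iff₀ (by positivity), mul_comm]
  exact h.trans (add_le_add (hC a ha) (hD a ha))

theorem symbol_apply_dyadic (γ : ℝ) {j : ℕ} {k : ℤ} (h1 : (2 : ℝ) ^ j ≤ 2 * |(k : ℝ)|)
    (h2 : |(k : ℝ)| ≤ 2 ^ (j + 1)) :
    (((1 + (k : ℝ) ^ 2) ^ (γ / 2) : ℝ) : ℂ)
      = (((2 : ℝ) ^ (j * γ : ℝ) : ℝ) : ℂ) * symbol γ ((2 ^ j)⁻¹) (k / 2 ^ (j + 3)) := by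
  have hX : (0 : ℝ) < 2 ^ j := by positivity
  have habs : |(k : ℝ) / 2 ^ (j + 3)| = |(k : ℝ)| / (8 * 2 ^ j) := by
    rw [abs_div, abs_of_pos (by positivity : (0 : ℝ) < 2 ^ (j + 3)), pow_add]
    norm_num [mul_comm]
  have hsq : squareFun (Real.cos (2 * Real.pi * (k / 2 ^ (j + 3)))) = (k / 2 ^ j) ^ 2 := by
    rw [squareFun_cos]
    · rw [pow_add]
      congr 1
      field_simp
      ring
    · rw [habs, div_le_div_iff₀ (by norm_num) (by positivity)]
      linarith
    · rw [habs, div_le_div_iff₀ (by positivity) (by norm_num)]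
      rw [pow_succ] at h2
      linarith
  change _ = _ * symbolFun γ _
  rw [symbolFun, hsq, ← Complex.ofReal_mul]
  congr 1
  have h3 : ((2 : ℝ) ^ j)⁻¹ ^ 2 + ((k : ℝ) / 2 ^ j) ^ 2 = (1 + (k : ℝ) ^ 2) / (2 ^ j) ^ 2 := by
    field_simp
  have h4 : (((2 : ℝ) ^ j) ^ 2) ^ (γ / 2) = (2 : ℝ) ^ (j * γ : ℝ) := by
    rw [← Real.rpow_natCast, ← Real.rpow_natCast, ← Real.rpow_mul (by norm_num),
      ← Real.rpow_mul (by norm_num)]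
    congr 1
    push_cast
    ring
  change _ = _ * (((2 : ℝ) ^ j)⁻¹ ^ 2 + ((k : ℝ) / 2 ^ j) ^ 2) ^ (γ / 2)
  rw [h3, Real.div_rpow (by positivity) (by positivity), h4]
  field_simp

/-! ### Boundedness of superpositions of translations -/

theorem lintegral_torusVol_add {F : ℝ → ℝ≥0∞} (hF : Function.Periodic F 1) (y : ℝ) :
    ∫⁻ x, F (x + y) ∂torusVol = ∫⁻ x, F x ∂torusVol := by
  have h1 : ∫⁻ x in Set.Ioc (0 : ℝ) 1, F (x + y) = ∫⁻ x in Set.Ioc y (y + 1), F x := by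
    have h := (measurePreserving_add_right volume y).setLIntegral_comp_preimage_emb
      (measurableEmbedding_addRight y) F (Set.Ioc y (y + 1))
    rw [← h, Set.preimage_add_const_Ioc, sub_self, add_sub_cancel_left]
  have h2 := (isAddFundamentalDomain_Ioc one_pos y).setLIntegral_eq
    (isAddFundamentalDomain_Ioc one_pos 0) F (fun g x => by
      obtain ⟨n, hn⟩ := AddSubgroup.mem_zmultiples_iff.1 g.2
      change F ((g : ℝ) + x) = F x
      rw [← hn, add_comm]
      exact hF.zsmul n x)
  rw [zero_add] at h2
  exact h1.trans h2

theorem tsum_weight_ne_top :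
    ∑' n : ℤ, ENNReal.ofReal ((1 + (n : ℝ) ^ 2)⁻¹) ≠ ⊤ := by
  rw [← ENNReal.ofReal_tsum_of_nonneg (fun n => by positivity) summable_one_add_sq_inv]
  exact ENNReal.ofReal_ne_top

theorem eLpNorm_le_of_hasSum_translates {B g : ℝ → ℂ} (hB : Continuous B)
    (hper : Function.Periodic B 1) {c : ℤ → ℂ} {y : ℤ → ℝ} {A : ℝ} (hA : 0 ≤ A) {p : ℝ≥0∞}
    (hp : p ≠ 0) (hpt : p ≠ ⊤) {M : ℕ} (hM : 1 ≤ M * p.toReal)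
    (hc : ∀ n, ‖c n‖ ≤ A * ((1 + (n : ℝ) ^ 2)⁻¹) ^ (M + 1))
    (hg : ∀ x, HasSum (fun n => c n * B (x + y n)) (g x)) :
    eLpNorm g p torusVol ≤ ENNReal.ofReal A * (∑' n : ℤ, ENNReal.ofReal ((1 + (n : ℝ) ^ 2)⁻¹)) *
      (∑' n : ℤ, ENNReal.ofReal ((1 + (n : ℝ) ^ 2)⁻¹)) ^ (1 / p.toReal) *
        eLpNorm B p torusVol := by
  set r := p.toReal with hr
  have hr0 : 0 < r := ENNReal.toReal_pos hp hpt
  set w : ℤ → ℝ≥0∞ := fun n => ENNReal.ofReal ((1 + (n : ℝ) ^ 2)⁻¹) with hw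
  set S := ∑' n, w n with hS
  have hw1 : ∀ n, w n ≤ 1 := fun n => by
    rw [hw, ENNReal.ofReal_le_one]
    exact inv_le_one_of_one_le₀ (by nlinarith [sq_nonneg (n : ℝ)])
  have hwpow : ∀ n, (w n ^ M) ^ r ≤ w n := fun n => by
    rw [← ENNReal.rpow_natCast, ← ENNReal.rpow_mul]
    exact (ENNReal.rpow_le_rpow_of_exponent_ge (hw1 n) hM).trans (ENNReal.rpow_one _).le
  have hcn : ∀ n, ‖c n‖ₑ ≤ ENNReal.ofReal A * w n * w n ^ M := fun n => by
    rw [← ofReal_norm, mul_assoc, ← pow_succ', hw, ← ENNReal.ofReal_pow (by positivity),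
      ← ENNReal.ofReal_mul hA]
    exact ENNReal.ofReal_le_ofReal (hc n)
  have hpt' : ∀ x, ‖g x‖ₑ ^ r
      ≤ (ENNReal.ofReal A * S) ^ r * ∑' n, w n * ‖B (x + y n)‖ₑ ^ r := fun x => by
    have hterm : ∀ n, w n ^ M * ‖B (x + y n)‖ₑ
        ≤ (∑' n, w n * ‖B (x + y n)‖ₑ ^ r) ^ (1 / r) := fun n => by
      rw [one_div, ENNReal.le_rpow_inv_iff hr0, ENNReal.mul_rpow_of_nonneg _ _ hr0.le]
      refine le_trans ?_ (ENNReal.le_tsum n)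
      gcongr
      exact hwpow n
    have h1 : ‖g x‖ₑ ≤ ENNReal.ofReal A * S * (∑' n, w n * ‖B (x + y n)‖ₑ ^ r) ^ (1 / r) := by
      rw [← (hg x).tsum_eq]
      refine (enorm_tsum_le_tsum_enorm).trans ?_
      rw [hS, ← ENNReal.tsum_mul_left, ← ENNReal.tsum_mul_right]
      refine ENNReal.tsum_le_tsum fun n => ?_
      rw [enorm_mul]
      refine (mul_le_mul_left (hcn n) _).trans ?_
      rw [mul_assoc (ENNReal.ofReal A * w n)]
      gcongr
      exact hterm n
    refine (ENNReal.rpow_le_rpow h1 hr0.le).trans (le_of_eq ?_)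
    rw [ENNReal.mul_rpow_of_nonneg _ _ hr0.le, ← ENNReal.rpow_mul, one_div_mul_cancel hr0.ne',
      ENNReal.rpow_one]
  have hint : ∫⁻ x, ‖g x‖ₑ ^ r ∂torusVol
      ≤ (ENNReal.ofReal A * S) ^ r * (S * ∫⁻ x, ‖B x‖ₑ ^ r ∂torusVol) := by
    refine (lintegral_mono hpt').trans (le_of_eq ?_)
    have hmeas : ∀ n, Measurable fun x => ‖B (x + y n)‖ₑ ^ r := fun n =>
      ((hB.comp (continuous_add_const (y n))).measurable.enorm).pow_const r
    rw [lintegral_const_mul _ (Measurable.tsum fun n => (hmeas n).const_mul _),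
      lintegral_tsum fun n => ((hmeas n).const_mul _).aemeasurable]
    congr 1
    rw [hS, ← ENNReal.tsum_mul_right]
    refine tsum_congr fun n => ?_
    rw [lintegral_const_mul _ (hmeas n)]
    congr 1
    exact lintegral_torusVol_add (F := fun x => ‖B x‖ₑ ^ r) (fun x => by simp only [hper x]) (y n)
  rw [eLpNorm_eq_lintegral_rpow_enorm_toReal hp hpt, eLpNorm_eq_lintegral_rpow_enorm_toReal hp hpt]
  refine (ENNReal.rpow_le_rpow hint (by positivity)).trans (le_of_eq ?_)
  have hr0' : 0 ≤ 1 / p.toReal := by positivity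
  rw [ENNReal.mul_rpow_of_nonneg _ _ hr0', ENNReal.mul_rpow_of_nonneg S _ hr0',
    ← ENNReal.rpow_mul, mul_one_div_cancel hr0.ne', ENNReal.rpow_one, ← mul_assoc]

/-! ### The Sobolev operator -/

variable {Φ : DyadicSystem} {f : GeneralizedFunction}

theorem expFun_add (k : ℤ) (x y : ℝ) : expFun k (x + y) = expFun k x * expFun k y := by
  rw [expFun, expFun, expFun, ← Complex.exp_add]
  congr 1
  push_cast
  ring

theorem periodic_block (j : ℕ) : Function.Periodic (block Φ f j) 1 := fun x => by
  simp only [block, periodic_expFun _ x]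

theorem fourierCoef_sobolevOp (γ : ℝ) (f : GeneralizedFunction) (k : ℤ) :
    fourierCoef (sobolevOp γ f) k = (((1 + (k : ℝ) ^ 2) ^ (γ / 2) : ℝ) : ℂ) * fourierCoef f k :=
  fourierCoef_fourierSeries _ _ k

theorem hasSum_block_sobolevOp (γ : ℝ) {j : ℕ} (hj : j ≠ 0) (x : ℝ) :
    HasSum (fun n : ℤ => expPairing (-n) (symbol γ ((2 ^ j)⁻¹)) *
        ((((2 : ℝ) ^ (j * γ : ℝ) : ℝ) : ℂ) • block Φ f j) (x + n / 2 ^ (j + 3)))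
      (block Φ (sobolevOp γ f) j x) := by
  have hterm : ∀ k ∈ Finset.Icc (-2 ^ (j + 1) : ℤ) (2 ^ (j + 1)),
      HasSum (fun n : ℤ => expPairing (-n) (symbol γ ((2 ^ j)⁻¹)) *
        ((((2 : ℝ) ^ (j * γ : ℝ) : ℝ) : ℂ) * ((dyadicFun Φ.φ₀ Φ.φ j k : ℂ) * fourierCoef f k *
          expFun k (x + n / 2 ^ (j + 3)))))
      ((dyadicFun Φ.φ₀ Φ.φ j k : ℂ) * fourierCoef (sobolevOp γ f) k * expFun k x) := fun k _ => by
    by_cases h0 : dyadicFun Φ.φ₀ Φ.φ j k = 0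
    · simp only [h0, Complex.ofReal_zero, zero_mul, mul_zero]
      exact hasSum_zero
    have h := ((symbol γ ((2 ^ j)⁻¹)).hasSum_expPairing_mul_expFun (k / 2 ^ (j + 3))).mul_left
      ((((2 : ℝ) ^ (j * γ : ℝ) : ℝ) : ℂ) * ((dyadicFun Φ.φ₀ Φ.φ j k : ℂ) * fourierCoef f k *
          expFun k x))
    have hv : (((2 : ℝ) ^ (j * γ : ℝ) : ℝ) : ℂ) * ((dyadicFun Φ.φ₀ Φ.φ j k : ℂ) * fourierCoef f k *
          expFun k x) * symbol γ ((2 ^ j)⁻¹) (k / 2 ^ (j + 3))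
        = (dyadicFun Φ.φ₀ Φ.φ j k : ℂ) * fourierCoef (sobolevOp γ f) k * expFun k x := by
      rw [fourierCoef_sobolevOp, symbol_apply_dyadic γ (le_abs_of_dyadicFun_ne_zero Φ hj h0)
        (abs_le_of_dyadicFun_ne_zero Φ h0)]
      ring
    rw [hv] at h
    refine h.congr_fun fun n => ?_
    have hsymm : expFun n (k / 2 ^ (j + 3)) = expFun k (n / 2 ^ (j + 3)) := by
      rw [expFun, expFun]
      congr 1
      push_cast
      ring
    rw [expFun_add, hsymm]
    ring
  rw [block_eq_sum]
  refine (hasSum_sum hterm).congr_fun fun n => ?_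
  rw [Pi.smul_apply, block_eq_sum, smul_eq_mul, Finset.mul_sum, Finset.mul_sum]

theorem MemBesov.sobolevOp_of_ne_top (γ : ℝ) {s : ℝ} {p : ℝ≥0∞} (hp : p ≠ 0) (hpt : p ≠ ⊤)
    (h : MemBesov Φ f s p ⊤) : MemBesov Φ (sobolevOp γ f) (s - γ) p ⊤ := by
  obtain ⟨C, hC, hb⟩ := memBesov_top_iff.1 h
  obtain ⟨s₀, hs₀⟩ := exists_memBesov Φ (sobolevOp γ f)
  obtain ⟨D, hD, hbD⟩ := memBesov_top_iff.1 (hs₀ p)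
  have hr0 : 0 < p.toReal := ENNReal.toReal_pos hp hpt
  set M : ℕ := ⌈p.toReal⁻¹⌉₊
  have hM : 1 ≤ M * p.toReal := by
    rw [← div_le_iff₀ hr0, one_div]
    exact Nat.le_ceil _
  obtain ⟨A, hA, hAb⟩ := exists_expPairing_symbol_le γ (M + 1)
  set K : ℝ≥0∞ := ENNReal.ofReal A * (∑' n : ℤ, ENNReal.ofReal ((1 + (n : ℝ) ^ 2)⁻¹)) *
      (∑' n : ℤ, ENNReal.ofReal ((1 + (n : ℝ) ^ 2)⁻¹)) ^ (1 / p.toReal)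
  have hK : K ≠ ⊤ := ENNReal.mul_ne_top (ENNReal.mul_ne_top ENNReal.ofReal_ne_top tsum_weight_ne_top)
    (ENNReal.rpow_ne_top_of_nonneg (by positivity) tsum_weight_ne_top)
  refine memBesov_top_iff.2 ⟨max D (K * C), by simp [hD, ENNReal.mul_ne_top hK hC], fun j => ?_⟩
  rcases eq_or_ne j 0 with rfl | hj
  · refine le_trans ?_ (le_max_left _ _)
    have := hbD 0
    simpa [blockNorm] using this
  refine le_trans ?_ (le_max_right _ _)
  have ha : ((2 : ℝ) ^ j)⁻¹ ∈ Set.Icc (0 : ℝ) 1 :=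
    ⟨by positivity, inv_le_one_of_one_le₀ (one_le_pow₀ one_le_two)⟩
  have h1 := eLpNorm_le_of_hasSum_translates
    (B := (((2 : ℝ) ^ (j * γ : ℝ) : ℝ) : ℂ) • block Φ f j)
    ((continuous_block Φ f j).const_smul _)
    (fun x => by simp only [Pi.smul_apply, periodic_block j x])
    hA hp hpt hM (hAb _ ha) (hasSum_block_sobolevOp γ hj)
  rw [eLpNorm_const_smul] at h1
  have h2 : ‖(((2 : ℝ) ^ (j * γ : ℝ) : ℝ) : ℂ)‖ₑ = (2 : ℝ≥0∞) ^ (j * γ : ℝ) := by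
    rw [← ofReal_norm, Complex.norm_real, Real.norm_of_nonneg (by positivity),
      ← ENNReal.ofReal_rpow_of_pos (by norm_num)]
    norm_num
  rw [h2] at h1
  calc blockNorm Φ (sobolevOp γ f) (s - γ) p j
      ≤ 2 ^ (j * (s - γ) : ℝ) * (K * (2 ^ (j * γ : ℝ) * eLpNorm (block Φ f j) p torusVol)) := by
        rw [blockNorm]; gcongr
    _ = K * blockNorm Φ f s p j := by
        have h3 : (2 : ℝ≥0∞) ^ ((j : ℝ) * s) = 2 ^ (j * (s - γ) : ℝ) * 2 ^ (j * γ : ℝ) := by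
          rw [← ENNReal.rpow_add _ _ (by simp) (by simp)]
          congr 1
          ring
        rw [blockNorm, h3]
        ring
    _ ≤ K * C := by gcongr; exact hb j

end Multiplier

/-! ### The critical smoothness as a function of `1/p` -/

section CriticalSmoothness

open Filter Topology Set

variable {Φ : DyadicSystem} {f : GeneralizedFunction}

theorem inv_ofReal_pos (t : ℝ) : 0 < (ENNReal.ofReal t)⁻¹ := by simp

theorem inv_ofReal_recip {p : ℝ≥0∞} (hp : 0 < p) : (ENNReal.ofReal (recip p))⁻¹ = p := by
  rw [recip, ENNReal.ofReal_toReal (ENNReal.inv_ne_top.2 hp.ne'), inv_inv]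

theorem recip_nonneg (p : ℝ≥0∞) : 0 ≤ recip p := ENNReal.toReal_nonneg

theorem recip_pos {p : ℝ≥0∞} (hp : 0 < p) (hpt : p ≠ ⊤) : 0 < recip p :=
  ENNReal.toReal_pos (ENNReal.inv_ne_zero.2 hpt) (ENNReal.inv_ne_top.2 hp.ne')

theorem recip_top : recip ⊤ = 0 := by simp [recip]

theorem recip_anti {p p' : ℝ≥0∞} (hp : 0 < p) (h : p ≤ p') : recip p' ≤ recip p :=
  ENNReal.toReal_mono (ENNReal.inv_ne_top.2 hp.ne') (ENNReal.inv_le_inv.2 h)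

theorem criticalSmoothness_ne_bot {p : ℝ≥0∞} (hp : 0 < p) : criticalSmoothness Φ f p ≠ ⊥ := by
  obtain ⟨s, hs⟩ := exists_memBesov Φ f
  exact ((EReal.bot_lt_coe s).trans_le (le_criticalSmoothness hp (hs p))).ne'

theorem criticalSmoothness_ne_top (hf : ¬ IsSmooth f) {p : ℝ≥0∞} (hp : 0 < p) :
    criticalSmoothness Φ f p ≠ ⊤ := fun h => by
  refine hf (isSmooth_of_forall_memBesov (Φ := Φ) fun s => ?_)
  have h1 : MemBesov Φ f (s + recip p) (ENNReal.ofReal (recip p))⁻¹ ⊤ := by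
    rw [inv_ofReal_recip hp]
    exact memBesov_of_lt_criticalSmoothness hp (h ▸ EReal.coe_lt_top _)
  simpa using h1.sub_top (recip_nonneg p)

theorem coe_criticalFun (hf : ¬ IsSmooth f) (t : ℝ) :
    (criticalFun Φ f t : EReal) = criticalSmoothness Φ f (ENNReal.ofReal t)⁻¹ :=
  EReal.coe_toReal (criticalSmoothness_ne_top hf (inv_ofReal_pos t))
    (criticalSmoothness_ne_bot (inv_ofReal_pos t))

theorem criticalSmoothness_eq_coe (hf : ¬ IsSmooth f) {p : ℝ≥0∞} (hp : 0 < p) :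
    criticalSmoothness Φ f p = (criticalFun Φ f (recip p) : EReal) := by
  rw [coe_criticalFun hf, inv_ofReal_recip hp]

theorem le_criticalFun (hf : ¬ IsSmooth f) {s t : ℝ}
    (h : MemBesov Φ f s (ENNReal.ofReal t)⁻¹ ⊤) : s ≤ criticalFun Φ f t := by
  rw [← EReal.coe_le_coe_iff, coe_criticalFun hf]
  exact le_criticalSmoothness (inv_ofReal_pos t) h

theorem memBesov_of_lt_criticalFun (hf : ¬ IsSmooth f) {s t : ℝ} (h : s < criticalFun Φ f t) :
    MemBesov Φ f s (ENNReal.ofReal t)⁻¹ ⊤ := by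
  rw [← EReal.coe_lt_coe_iff, coe_criticalFun hf] at h
  exact memBesov_of_lt_criticalSmoothness (inv_ofReal_pos t) h

theorem concaveOn_criticalFun (hf : ¬ IsSmooth f) : ConcaveOn ℝ (Ici 0) (criticalFun Φ f) := by
  refine ⟨convex_Ici 0, fun t ht u hu a b ha hb hab => ?_⟩
  simp only [smul_eq_mul]
  rcases ha.eq_or_lt with rfl | ha
  · obtain rfl : b = 1 := by linarith
    simp
  rcases hb.eq_or_lt with rfl | hb
  · obtain rfl : a = 1 := by linarith
    simp
  refine le_of_forall_pos_le_add fun ε hε => ?_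
  have h := le_criticalFun hf (MemBesov.interpolate ha hb hab ht hu
    (memBesov_of_lt_criticalFun hf (sub_lt_self (criticalFun Φ f t) hε))
    (memBesov_of_lt_criticalFun hf (sub_lt_self (criticalFun Φ f u) hε)))
  have h2 : a * (criticalFun Φ f t - ε) + b * (criticalFun Φ f u - ε)
      = a * criticalFun Φ f t + b * criticalFun Φ f u - (a + b) * ε := by ring
  rw [h2, hab] at h
  linarith

theorem monotoneOn_criticalFun (hf : ¬ IsSmooth f) : MonotoneOn (criticalFun Φ f) (Ici 0) := by
  intro t _ u _ htu
  refine le_of_forall_pos_le_add fun ε hε => ?_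
  have h := le_criticalFun hf ((memBesov_of_lt_criticalFun hf
    (sub_lt_self (criticalFun Φ f t) hε)).mono_exponent
      (ENNReal.inv_le_inv.2 (ENNReal.ofReal_le_ofReal htu)))
  linarith

theorem criticalFun_le_add (hf : ¬ IsSmooth f) {t : ℝ} (ht : 0 ≤ t) :
    criticalFun Φ f t ≤ criticalFun Φ f 0 + t := by
  refine le_of_forall_pos_le_add fun ε hε => ?_
  have h1 := (memBesov_of_lt_criticalFun hf (sub_lt_self (criticalFun Φ f t) hε)).sub_top ht
  have h : criticalFun Φ f t - ε - t ≤ criticalFun Φ f 0 := le_criticalFun hf (by simpa using h1)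
  linarith

theorem MemBesov.sobolevOp (γ : ℝ) {s r : ℝ} {p : ℝ≥0∞} (hp : p ≠ 0) (hr : r < s - γ)
    (h : MemBesov Φ f s p ⊤) : MemBesov Φ (sobolevOp γ f) r p ⊤ := by
  by_cases hpt : p = ⊤
  · subst hpt
    have hε : 0 < s - γ - r := sub_pos.2 hr
    have h1 := ((h.mono_exponent (p := (ENNReal.ofReal (s - γ - r))⁻¹) le_top).sobolevOp_of_ne_top γ
      (inv_ofReal_pos _).ne'
      (ENNReal.inv_ne_top.2 (ENNReal.ofReal_pos.2 hε).ne')).sub_top hε.le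
    rwa [sub_sub_cancel] at h1
  · exact (h.sobolevOp_of_ne_top γ hp hpt).of_top ENNReal.zero_lt_top hr

theorem sobolevOp_neg_sobolevOp (γ : ℝ) (f : GeneralizedFunction) :
    PeriodicBesov.sobolevOp (-γ) (PeriodicBesov.sobolevOp γ f) = f := by
  ext u
  refine (hasSum_fourierCoef_mul_expPairing _ u).unique
    ((hasSum_fourierCoef_mul_expPairing f u).congr_fun fun k => ?_)
  have h : (0 : ℝ) < 1 + (k : ℝ) ^ 2 := by positivity
  rw [fourierCoef_sobolevOp, fourierCoef_sobolevOp, ← mul_assoc, ← Complex.ofReal_mul,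
    ← Real.rpow_add h, neg_div, neg_add_cancel, Real.rpow_zero, Complex.ofReal_one, one_mul]

theorem criticalSmoothness_sobolevOp (hf : ¬ IsSmooth f) (γ : ℝ) {p : ℝ≥0∞} (hp : 0 < p) :
    criticalSmoothness Φ (PeriodicBesov.sobolevOp γ f) p
      = criticalSmoothness Φ f p - (γ : EReal) := by
  have hc := criticalSmoothness_eq_coe (Φ := Φ) hf hp
  rw [hc, ← EReal.coe_sub]
  refine le_antisymm (iSup₂_le fun s hs => ?_) (not_lt.1 fun hlt => ?_)
  · rw [EReal.coe_le_coe_iff, le_sub_iff_add_le]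
    refine le_of_forall_pos_le_add fun ε hε => ?_
    have h := MemBesov.sobolevOp (-γ) hp.ne' (r := s + γ - ε) (by linarith) (hs.to_top hp)
    rw [sobolevOp_neg_sobolevOp] at h
    have := le_criticalSmoothness hp h
    rw [hc, EReal.coe_le_coe_iff] at this
    linarith
  · obtain ⟨r, hr1, hr2⟩ := EReal.lt_iff_exists_real_btwn.1 hlt
    rw [EReal.coe_lt_coe_iff] at hr2
    obtain ⟨s, hs1, hs2⟩ := exists_between (lt_sub_iff_add_lt.1 hr2)
    have h : MemBesov Φ f s p ⊤ :=
      memBesov_of_lt_criticalSmoothness hp (by rw [hc]; exact EReal.coe_lt_coe_iff.2 hs2)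
    exact hr1.not_ge (le_criticalSmoothness hp (h.sobolevOp γ hp.ne' (by linarith)))

theorem criticalSmoothness_of_hasLeftDiff_one (hf : ¬ IsSmooth f) {p₀ p : ℝ≥0∞} (hp₀ : 0 < p₀)
    (hl : HasLeftDiff Φ f p₀ 1) (hp : p₀ ≤ p) :
    criticalSmoothness Φ f p = criticalSmoothness Φ f p₀ + ((recip p - recip p₀ : ℝ) : EReal) := by
  rw [criticalSmoothness_eq_coe hf hp₀, criticalSmoothness_eq_coe hf (hp₀.trans_le hp),
    ← EReal.coe_add, eq_add_sub_of_hasDerivWithinAt_one (concaveOn_criticalFun hf)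
      (fun _ => criticalFun_le_add hf) (recip_nonneg p) (recip_anti hp₀ hp) hl]

theorem criticalSmoothness_of_hasRightDiff_zero (hf : ¬ IsSmooth f) {p₀ p : ℝ≥0∞} (hp : 0 < p)
    (hr : HasRightDiff Φ f p₀ 0) (hpp : p ≤ p₀) :
    criticalSmoothness Φ f p = criticalSmoothness Φ f p₀ := by
  rw [criticalSmoothness_eq_coe hf hp, criticalSmoothness_eq_coe hf (hp.trans_le hpp),
    eq_of_hasDerivWithinAt_zero (concaveOn_criticalFun hf) (monotoneOn_criticalFun hf)
      (recip_nonneg p₀) (recip_anti hp hpp) hr]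

theorem criticalSmoothness_eq_add_recip_max (hf : ¬ IsSmooth f) {p₀ p : ℝ≥0∞} (hp₀ : 0 < p₀)
    (hl : HasLeftDiff Φ f p₀ 1) (hr : HasRightDiff Φ f p₀ 0) (hp : 0 < p) :
    criticalSmoothness Φ f p
      = criticalSmoothness Φ f p₀ + ((recip (max p p₀) - recip p₀ : ℝ) : EReal) := by
  rcases le_total p p₀ with h | h
  · rw [max_eq_right h, sub_self, EReal.coe_zero, add_zero]
    exact criticalSmoothness_of_hasRightDiff_zero hf hp hr h
  · rw [max_eq_left h]
    exact criticalSmoothness_of_hasLeftDiff_one hf hp₀ hl h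

end CriticalSmoothness

end PeriodicBesov

end

open PeriodicBesov

theorem mainTheorem4 (Φ : PeriodicBesov.DyadicSystem) (f : PeriodicBesov.GeneralizedFunction)
    (hf : ¬ PeriodicBesov.IsSmooth f) :
    -- `s_f(p)` is a real number, and it is the common value of the `s_f(p,q)`
    (∀ p : ENNReal, 0 < p →
      PeriodicBesov.criticalSmoothness Φ f p ≠ ⊥ ∧ PeriodicBesov.criticalSmoothness Φ f p ≠ ⊤ ∧
      ∀ q : ENNReal, 0 < q →
        PeriodicBesov.criticalSmoothnessPQ Φ f p q = PeriodicBesov.criticalSmoothness Φ f p) ∧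
    -- effect of the Sobolev operator
    (∀ γ : ℝ, ∀ p : ENNReal, 0 < p →
      PeriodicBesov.criticalSmoothness Φ (PeriodicBesov.sobolevOp γ f) p
        = PeriodicBesov.criticalSmoothness Φ f p - (γ : EReal)) ∧
    -- one-sided differentiability
    (∀ p₀ : ENNReal, 0 < p₀ → ∃ d : ℝ, PeriodicBesov.HasRightDiff Φ f p₀ d) ∧
    (∀ p₀ : ENNReal, 0 < p₀ → p₀ ≠ ⊤ → ∃ d : ℝ, PeriodicBesov.HasLeftDiff Φ f p₀ d) ∧
    -- the left derivative is at least the right derivative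
    (∀ p : ENNReal, 0 < p → p ≠ ⊤ → ∀ dl dr : ℝ, PeriodicBesov.HasLeftDiff Φ f p dl →
      PeriodicBesov.HasRightDiff Φ f p dr → dr ≤ dl) ∧
    -- at most countably many points of non-differentiability in `[0, ∞)`
    {t : ℝ | 0 ≤ t ∧
      ¬ DifferentiableWithinAt ℝ (PeriodicBesov.criticalFun Φ f) (Set.Ici 0) t}.Countable ∧
    -- slope `1` on the left
    (∀ p₀ : ENNReal, 0 < p₀ → p₀ ≠ ⊤ → PeriodicBesov.HasLeftDiff Φ f p₀ 1 →
      ∀ p : ENNReal, p₀ ≤ p →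
        PeriodicBesov.criticalSmoothness Φ f p
          = PeriodicBesov.criticalSmoothness Φ f p₀
            + ((PeriodicBesov.recip p - PeriodicBesov.recip p₀ : ℝ) : EReal)) ∧
    -- slope `0` on the right
    (∀ p₀ : ENNReal, 0 < p₀ → PeriodicBesov.HasRightDiff Φ f p₀ 0 →
      ∀ p : ENNReal, 0 < p → p ≤ p₀ →
        PeriodicBesov.criticalSmoothness Φ f p = PeriodicBesov.criticalSmoothness Φ f p₀) ∧
    -- both
    (∀ p₀ : ENNReal, 0 < p₀ → p₀ ≠ ⊤ → PeriodicBesov.HasLeftDiff Φ f p₀ 1 →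
      PeriodicBesov.HasRightDiff Φ f p₀ 0 → ∀ p : ENNReal, 0 < p →
        PeriodicBesov.criticalSmoothness Φ f p
          = PeriodicBesov.criticalSmoothness Φ f p₀
            + ((PeriodicBesov.recip (max p p₀) - PeriodicBesov.recip p₀ : ℝ) : EReal) ∧
        PeriodicBesov.criticalSmoothness Φ f p
          = PeriodicBesov.criticalSmoothness Φ f ⊤
            + ((PeriodicBesov.recip (max p p₀) : ℝ) : EReal)) := by
  have hc := concaveOn_criticalFun (Φ := Φ) hf
  have h1 : ∀ t, 0 ≤ t → criticalFun Φ f t ≤ criticalFun Φ f 0 + t :=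
    fun _ => criticalFun_le_add hf
  refine ⟨fun p hp => ⟨criticalSmoothness_ne_bot hp, criticalSmoothness_ne_top hf hp, fun q hq => ?_⟩,
    fun γ p hp => criticalSmoothness_sobolevOp hf γ hp,
    fun p₀ _ => exists_hasDerivWithinAt_Ici hc h1 (recip_nonneg p₀),
    fun p₀ hp₀ hpt => exists_hasDerivWithinAt_Iic hc (recip_pos hp₀ hpt),
    fun p hp hpt dl dr hl hr => right_le_left_of_hasDerivWithinAt hc (recip_pos hp hpt) hl hr,
    countable_not_differentiableWithinAt hc h1,
    fun p₀ hp₀ _ hl p hp => criticalSmoothness_of_hasLeftDiff_one hf hp₀ hl hp,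
    fun p₀ _ hr p hp hpp => criticalSmoothness_of_hasRightDiff_zero hf hp hr hpp,
    fun p₀ hp₀ _ hl hr p hp => ?_⟩
  · rw [criticalSmoothness, criticalSmoothnessPQ_eq_top hq, criticalSmoothnessPQ_eq_top hp]
  · have h := criticalSmoothness_eq_add_recip_max hf hp₀ hl hr hp
    refine ⟨h, ?_⟩
    rw [h, criticalSmoothness_of_hasLeftDiff_one hf hp₀ hl le_top, recip_top, add_assoc,
      ← EReal.coe_add]
    congr 2
    ring
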